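/- Let $C=C^\infty(S^1,\mathbb R)$, $S^1=\mathbb R/\mathbb Z$ (smooth functions of period $1$), $\int$ the integral over $S^1$, and $\mathcal M=C^\infty(S^1,\mathfrak{sl}(2))$, with points $S=\begin{pmatrix}p&q\\ r&-p\end{pmatrix}$. Covectors are identified with tangent vectors through $\langle V,W\rangle=\int\mathrm{tr}(VW)\,dx$; the differential $dH$ of a functional $H$ at $S$ is the element of $\mathcal M$ with $\frac{d}{dt}\big|_{t=0}H(S+tV)=\langle dH,V\rangle$ for all $V\in\mathcal M$. Let $A=\frac12\begin{pmatrix}0&1\\1&0\end{pmatrix}$, $P_1=[\,\cdot\,,S]$, $P_2=\partial_x+[\,\cdot\,,A]$. Consider, for formal series $h=\sum_{i\ge0}h_i\lambda^{-i}$ with $h_i\in C$, the Riccati equation $$(h_x+h^2)(2r-\lambda)\lambda^2-2r_xh\lambda^2=-\tfrac14\lambda^3+(r+\tfrac12q-p_x)\lambda^2+(-r^2-2r_xp-2qr+2p_xr-p^2)\lambda+2qr^2+2p^2r.\qquad(\ast)$$ **1. Formal solution.** The operator $1+\partial_x$ is bijective on $C$. For every $S$, every solution of $(\ast)$ has $h_0=\frac12$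 or $h_0=-\frac12$. If $h_0=\frac12$, then $(\ast)$ is equivalent to the equations, for all $i\ge0$, $$h_{i+1}+(h_{i+1})_x=2r\Big((h_i)_x+\sum_{j=0}^{i}h_jh_{i-j}\Big)-2r_xh_i-\sum_{j=1}^{i}h_jh_{i+1-j}-c_i,$$ where $c_0=r+\frac12q-p_x$, $c_1=-r^2-2r_xp-2qr+2p_xr-p^2$, $c_2=2qr^2+2p^2r$ and $c_i=0$ for $i\ge3$. Consequently $(\ast)$ has a unique solution $h$ with $h_0=\frac12$. **2. Hierarchy.** Let $H_j=\int h_j\,dx$ for this solution. $P_1,P_2$ are compatible Poisson tensors on $\mathcal M$ (all $sP_1+tP_2$ are skew-symmetric and satisfy the Jacobi identity). For $j\ge1$ the differential $dH_j\in\mathcal M$ exists at every point, and $$P_2\,dH_1=0,\qquad P_2\,dH_{j+1}=P_1\,dH_j\quad(j\ge1).$$ Moreover $V=\sum_{j\ge1}dH_j\lambda^{-j}$ satisfies $\frac12\mathrm{tr}\,V^2=F(\lambda)=\frac1{4\lambda^2}$. One has $$H_1=-\tfrac12\int(r+q)\,dx,\qquad H_2=\int(p^2-\gamma^2-\gamma_x^2)\,dx,$$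 where $\gamma\in C$ is the unique solution of $\gamma_{xx}-\gamma=\frac12(q-r)-p_x$, and $P_1dH_2$ is the vector field $\dot p=-\gamma(r+q)$, $\dot q=2q(\gamma_x+p)+2p\gamma$, $\dot r=2p\gamma-2r(p+\gamma_x)$. **3. Reduction.** Let $\mathcal S=\{S\in\mathcal M: p^2+qr=0,\ S(x)\ne0\ \forall x\}$, with tangent spaces $T_S\mathcal S=\{2p\dot p+r\dot q+q\dot r=0\}$; let $D=P_2(\mathrm{Ker}\,P_1)$, $E=D\cap T\mathcal S$, and let $\mathcal Q\subset\mathcal S$ consist of the points $S(q)=\begin{pmatrix}0&q\\0&0\end{pmatrix}$ with $q$ nowhere zero. Then $T_S\mathcal S$ is the image of $P_1$ at each $S\in\mathcal S$, and $T\mathcal Q\oplus E=T\mathcal S$ at the points of $\mathcal Q$; let $\Pi$ be the projection on $T\mathcal Q\cong C$. Identify covectors of $\mathcal Q$ with $a\in C$ through $\dot q\mapsto\int a\dot q\,dx$. Each $a$ has an extension, i.e. a covector $\alpha$ of $\mathcal M$ at $S(q)$ which vanishes on $D$ and restricts to $a$ on $T\mathcal Q$; and for every extension, $P_i\alpha$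 is tangent to $\mathcal S$ and $$\Pi(P_1\alpha)=P_1^{\rm rd}a,\quad \Pi(P_2\alpha)=P_2^{\rm rd}a,\qquad P_1^{\rm rd}=2(2q\,\partial_x+q_x),\quad P_2^{\rm rd}=2(-\partial_x^3+\partial_x).$$ For $j\ge1$, $dH_j$ vanishes on $E$ along $\mathcal S$. Let $K_j(q)=H_j(S(q))$. The $K_j$ have differentials $dK_j$ on $\mathcal Q$; along $\mathcal S$ the vector fields $P_1dH_j$ are tangent to $\mathcal S$, and at the points of $\mathcal Q$ the vector fields $P_1dH_j$ and $P_2dH_j$ are tangent to $\mathcal S$ and project by $\Pi$ to $P_1^{\rm rd}dK_j$ and $P_2^{\rm rd}dK_j$. The functionals $K_j$ are the usual nonlocal (scalar) CH hierarchy: $P_1^{\rm rd},P_2^{\rm rd}$ are compatible Poisson tensors on $\mathcal Q$; $K_1=-\frac12\int q\,dx$, $P_2^{\rm rd}dK_1=0$ and $P_2^{\rm rd}dK_{j+1}=P_1^{\rm rd}dK_j$ for $j\ge1$; $K_j=\int k_j\,dx$, where $k=\sum_{i\ge0}k_i\lambda^{-i}$ is the unique formal solution with $k_0=\frac12$ of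 the scalar Riccati equation $k_x+k^2=\frac14-\frac{q}{2\lambda}$; and for $q=u-u_{xx}$ nowhere zero, $P_1^{\rm rd}dK_2=-3uu_x+2u_xu_{xx}+uu_{xxx}$, so that $q_t=P_1^{\rm rd}dK_2$ is the Camassa–Holm equation. -/

import Mathlib

namespace MatrixCH

open scoped ContDiff

/-! ### Smooth functions on the circle `S¹ = ℝ/ℤ` and loops in `sl(2)` -/

/-- `C^∞(S¹, ℝ)`, as the algebra of smooth functions on the line of period `1`. -/
def smoothCircle : Subalgebra ℝ (ℝ → ℝ) where
  carrier := {f | ContDiff ℝ ∞ f ∧ Function.Periodic f 1}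
  mul_mem' := fun ha hb => ⟨ha.1.mul hb.1, ha.2.mul hb.2⟩
  add_mem' := fun ha hb => ⟨ha.1.add hb.1, ha.2.add hb.2⟩
  algebraMap_mem' := fun _ => ⟨contDiff_const, fun _ => rfl⟩

/-- `C^∞(S¹, ℝ)` as a type. -/
abbrev Fn : Type := smoothCircle

instance : CommRing Fn := inferInstanceAs (CommRing smoothCircle)
instance : Algebra ℝ Fn := inferInstanceAs (Algebra ℝ smoothCircle)

theorem Fn.differentiable (f : Fn) : Differentiable ℝ f.1 :=
  f.2.1.differentiable (by simp)

theorem Fn.deriv_mem (f : Fn) : deriv f.1 ∈ smoothCircle := by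
  refine ⟨(contDiff_infty_iff_deriv.1 f.2.1).2, fun x => ?_⟩
  have h : (fun y => f.1 (y + 1)) = f.1 := funext f.2.2
  rw [← deriv_comp_add_const, h]

/-- The derivation `∂_x` of `C^∞(S¹, ℝ)`. -/
noncomputable def dx : Derivation ℝ Fn Fn :=
  Derivation.mk'
    { toFun := fun f => ⟨deriv f.1, f.deriv_mem⟩
      map_add' := fun f g => Subtype.ext <| funext fun x =>
        deriv_add (f.differentiable x) (g.differentiable x)
      map_smul' := fun c f => Subtype.ext <| funext fun x =>
        deriv_const_mul c (f.differentiable x) }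
    (fun f g => Subtype.ext <| funext fun x => by
      have h := deriv_mul (f.differentiable x) (g.differentiable x)
      change deriv (f.1 * g.1) x = f.1 x * deriv g.1 x + g.1 x * deriv f.1 x
      rw [h]; ring)

theorem dx_apply (f : Fn) (x : ℝ) : (dx f).1 x = deriv f.1 x := rfl

/-- The integral over the circle. -/
noncomputable def integral (f : Fn) : ℝ := ∫ x in (0 : ℝ)..1, f.1 x

/-- The loop space `C^∞(S¹, sl(2))`: traceless `2 × 2` matrices whose entries are smooth functions
on the circle. The bracket `⁅·, ·⁆` is the (pointwise) commutator of matrices. -/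
abbrev Loop : Type := LieAlgebra.SpecialLinear.sl (Fin 2) Fn

attribute [local instance 100] LieRing.ofAssociativeRing

instance : Module ℝ Fn := Algebra.toModule
instance : Module ℝ Loop := (LieAlgebra.SpecialLinear.sl (Fin 2) Fn).toSubmodule.module'

/-- The loop `!![p, q; r, -p]`. -/
def mk (p q r : Fn) : Loop :=
  ⟨!![p, q; r, -p], by
    change Matrix.trace !![p, q; r, -p] = 0
    simp [Matrix.trace_fin_two]⟩

/-- The entry `p` of `S = !![p, q; r, -p]`. -/
def pOf (S : Loop) : Fn := S.1 0 0

/-- The entry `q` of `S = !![p, q; r, -p]`. -/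
def qOf (S : Loop) : Fn := S.1 0 1

/-- The entry `r` of `S = !![p, q; r, -p]`. -/
def rOf (S : Loop) : Fn := S.1 1 0

/-- The entrywise derivative `∂_x` on loops. -/
noncomputable def loopDx : Loop →ₗ[ℝ] Loop where
  toFun V := ⟨V.1.map dx, by
    have h : Matrix.trace V.1 = 0 := V.2
    change Matrix.trace (V.1.map dx) = 0
    rw [Matrix.trace_fin_two] at h ⊢
    simp only [Matrix.map_apply]
    rw [← map_add, h, map_zero]⟩
  map_add' V W := Subtype.ext <| Matrix.ext fun i j => map_add dx (V.1 i j) (W.1 i j)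
  map_smul' c V := Subtype.ext <| Matrix.ext fun i j => dx.map_smul c (V.1 i j)

/-- The form `⟨V₁, V₂⟩ = ∫ tr (V₁ V₂) dx`, which identifies covectors with tangent vectors. -/
noncomputable def pairing (V W : Loop) : ℝ := integral (Matrix.trace (V.1 * W.1))

/-- The linear map `[·, S]`. -/
def bracketWith (S : Loop) : Loop →ₗ[ℝ] Loop where
  toFun V := ⁅V, S⁆
  map_add' V W := add_lie V W S
  map_smul' c V := by
    apply Subtype.ext
    change (c • V).1 * S.1 - S.1 * (c • V).1 = c • (V.1 * S.1 - S.1 * V.1)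
    change (c • V.1) * S.1 - S.1 * (c • V.1) = c • (V.1 * S.1 - S.1 * V.1)
    rw [smul_mul_assoc, mul_smul_comm, smul_sub]

/-- The constant matrix `A = ½ !![0, 1; 1, 0]`. -/
noncomputable def matA : Loop := (1 / 2 : ℝ) • mk 0 1 1

/-- `P₁ = [·, S]`, at the point `S`. -/
def P₁ (S : Loop) : Loop →ₗ[ℝ] Loop := bracketWith S

/-- `P₂ = ∂_x + [·, A]`, at the point `S` (on which it does not depend). -/
noncomputable def P₂ (_S : Loop) : Loop →ₗ[ℝ] Loop := loopDx + bracketWith matA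

/-! ### Poisson tensors and bi-Hamiltonian hierarchies

`X` is a vector space whose covectors are represented by vectors through a form `B`; the phase
space is a subset `U` of `X`. -/

/-- `G` represents through `B` the differential at `S` of the functional `H`. -/
def IsGradient {X : Type} [AddCommGroup X] [Module ℝ X] (B : X → X → ℝ) (H : X → ℝ)
    (S G : X) : Prop :=
  ∀ V : X, HasDerivAt (fun t : ℝ => H (S + t • V)) (B G V) 0

/-- `P` is a Poisson tensor on `U`: skew-symmetric, and with the Jacobi identity. The latter is
tested on linear functionals `ℓ_a = B a`, for which `{ℓ_a, ℓ_b}(S) = B a (P S b)` and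
`{{ℓ_a, ℓ_b}, ℓ_c}(S)` is the derivative of `{ℓ_a, ℓ_b}` at `S` along `P S c`. -/
def IsPoissonTensor {X : Type} [AddCommGroup X] [Module ℝ X] (B : X → X → ℝ) (U : Set X)
    (P : X → X →ₗ[ℝ] X) : Prop :=
  (∀ S ∈ U, ∀ a b : X, B a (P S b) = -B b (P S a)) ∧
  ∀ S ∈ U, ∀ a b c : X, ∃ d₁ d₂ d₃ : ℝ,
    HasDerivAt (fun t : ℝ => B a (P (S + t • P S c) b)) d₁ 0 ∧
    HasDerivAt (fun t : ℝ => B b (P (S + t • P S a) c)) d₂ 0 ∧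
    HasDerivAt (fun t : ℝ => B c (P (S + t • P S b) a)) d₃ 0 ∧
    d₁ + d₂ + d₃ = 0

/-- Compatible Poisson tensors: all their linear combinations are Poisson tensors. -/
def IsBihamiltonianPair {X : Type} [AddCommGroup X] [Module ℝ X] (B : X → X → ℝ) (U : Set X)
    (P Q : X → X →ₗ[ℝ] X) : Prop :=
  ∀ s t : ℝ, IsPoissonTensor B U (fun S => s • P S + t • Q S)

/-- The functionals `H_j` (`j ≥ 1`), with differentials `dH_j`, form a bi-Hamiltonian hierarchy on
`U` for the pair `(P, Q)` starting from a Casimir of `Q`: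
`Q dH₁ = 0` and `Q dH_{j+1} = P dH_j`. -/
structure IsBihamiltonianHierarchy {X : Type} [AddCommGroup X] [Module ℝ X] (B : X → X → ℝ)
    (U : Set X) (P Q : X → X →ₗ[ℝ] X) (H : ℕ → X → ℝ) (dH : ℕ → X → X) : Prop where
  pair : IsBihamiltonianPair B U P Q
  gradient : ∀ j, 1 ≤ j → ∀ S ∈ U, IsGradient B (H j) S (dH j S)
  casimir : ∀ S ∈ U, Q S (dH 1 S) = 0
  recursion : ∀ j, 1 ≤ j → ∀ S ∈ U, Q S (dH (j + 1) S) = P S (dH j S)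

/-! ### The Riccati equation

Series in `λ⁻¹` are Laurent series over `C^∞(S¹, ℝ)` in the variable `λ⁻¹`. -/

/-- The spectral parameter `λ`, the inverse of the variable of the Laurent series. -/
noncomputable def lam : LaurentSeries Fn := HahnSeries.single (-1 : ℤ) (1 : Fn)

/-- A function, as a series that does not depend on `λ`. -/
noncomputable def cst (f : Fn) : LaurentSeries Fn := HahnSeries.C f

/-- The formal series `∑_{i ≥ 0} h_i λ^{-i}`. -/
noncomputable def series (h : ℕ → Fn) : LaurentSeries Fn :=
  HahnSeries.ofPowerSeries ℤ Fn (PowerSeries.mk h)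

/-- A real number, as a constant function on the circle. -/
noncomputable def const (c : ℝ) : Fn := algebraMap ℝ Fn c

/-- The Riccati equation `(h_x + h²)(2r - λ)λ² - 2 r_x h λ² = -λ³/4 + (r + q/2 - p_x)λ²
+ (-r² - 2 r_x p - 2qr + 2 p_x r - p²)λ + 2qr² + 2p²r` for `h = ∑ h_i λ^{-i}`. -/
def IsRiccatiSolution (S : Loop) (h : ℕ → Fn) : Prop :=
  let p := pOf S
  let q := qOf S
  let r := rOf S
  (series (fun i => dx (h i)) + series h ^ 2) * (2 * cst r - lam) * lam ^ 2
      - 2 * cst (dx r) * series h * lam ^ 2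
    = -(cst (const (1 / 4)) * lam ^ 3)
      + cst (r + const (1 / 2) * q - dx p) * lam ^ 2
      + cst (-r ^ 2 - 2 * dx r * p - 2 * q * r + 2 * dx p * r - p ^ 2) * lam
      + cst (2 * q * r ^ 2 + 2 * p ^ 2 * r)

/-- The coefficients of `λ²`, `λ`, `1`, `λ⁻¹`, … on the right-hand side of the Riccati equation. -/
noncomputable def riccatiCoeff (S : Loop) : ℕ → Fn
  | 0 => rOf S + const (1 / 2) * qOf S - dx (pOf S)
  | 1 => -rOf S ^ 2 - 2 * dx (rOf S) * pOf S - 2 * qOf S * rOf S + 2 * dx (pOf S) * rOf S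
      - pOf S ^ 2
  | 2 => 2 * qOf S * rOf S ^ 2 + 2 * pOf S ^ 2 * rOf S
  | _ => 0

/-- The right-hand side, a function of `h_0, …, h_i`, of the equation
`h_{i+1} + (h_{i+1})_x = …` that determines `h_{i+1}`. -/
noncomputable def riccatiSource (S : Loop) (h : ℕ → Fn) (i : ℕ) : Fn :=
  2 * rOf S * (dx (h i) + ∑ j ∈ Finset.range (i + 1), h j * h (i - j))
    - 2 * dx (rOf S) * h i
    - ∑ j ∈ Finset.range i, h (j + 1) * h (i - j)
    - riccatiCoeff S i

/-! ### The bi-Hamiltonian reduction -/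

/-- The submanifold `𝒮` of loops with `p² + qr = 0` that vanish nowhere. -/
def leaf : Set Loop :=
  {S | pOf S ^ 2 + qOf S * rOf S = 0 ∧
    ∀ x : ℝ, ((pOf S).1 x, (qOf S).1 x, (rOf S).1 x) ≠ (0, 0, 0)}

/-- The tangent space `T_S 𝒮`, given by the linearized constraint `2pṗ + rq̇ + qṙ = 0`. -/
def tangentLeaf (S : Loop) : Submodule ℝ Loop where
  carrier := {V | 2 * pOf S * pOf V + rOf S * qOf V + qOf S * rOf V = 0}
  add_mem' := by
    intro V W hV hW
    change 2 * pOf S * (pOf V + pOf W) + rOf S * (qOf V + qOf W) + qOf S * (rOf V + rOf W) = 0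
    simp only [Set.mem_ofPred_eq] at hV hW
    linear_combination hV + hW
  zero_mem' := by
    change 2 * pOf S * 0 + rOf S * 0 + qOf S * 0 = 0
    ring
  smul_mem' := by
    intro c V hV
    simp only [Set.mem_ofPred_eq] at hV
    change 2 * pOf S * (c • pOf V) + rOf S * (c • qOf V) + qOf S * (c • rOf V) = 0
    rw [mul_smul_comm, mul_smul_comm, mul_smul_comm, ← smul_add, ← smul_add, hV, smul_zero]

/-- The distribution `D = P₂ (Ker P₁)`. -/
noncomputable def distD (S : Loop) : Submodule ℝ Loop :=
  Submodule.map (P₂ S) (LinearMap.ker (P₁ S))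

/-- The distribution `E = D ∩ T𝒮` on `𝒮`. -/
noncomputable def distE (S : Loop) : Submodule ℝ Loop := distD S ⊓ tangentLeaf S

/-- Nowhere vanishing functions, the coordinates `q` of the points of `𝒬`. -/
def nonvanishing : Set Fn := {q | ∀ x : ℝ, q.1 x ≠ 0}

/-- The linear map `q ↦ S(q) = !![0, q; 0, 0]`. It maps `nonvanishing` onto the submanifold `𝒬`
of `𝒮`, and it identifies tangent vectors `q̇` with tangent vectors to `𝒬`. -/
def embQ : Fn →ₗ[ℝ] Loop where
  toFun q := mk 0 q 0
  map_add' a b := by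
    apply Subtype.ext
    change !![(0 : Fn), a + b; 0, -0] = !![(0 : Fn), a; 0, -0] + !![(0 : Fn), b; 0, -0]
    simp
  map_smul' c a := by
    apply Subtype.ext
    change !![(0 : Fn), c • a; 0, -0] = c • !![(0 : Fn), a; 0, -0]
    simp

/-- The tangent space to `𝒬` (at any of its points). -/
def tangentQ : Submodule ℝ Loop := LinearMap.range embQ

/-- The form `∫ a b dx`, which identifies covectors of `𝒬` with functions. -/
noncomputable def pairingQ (a b : Fn) : ℝ := integral (a * b)

/-- `W` is tangent to `𝒮` at `S(q)`, and its projection on `T𝒬` along `E` is `b`. -/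
def ProjectsTo (q : Fn) (W : Loop) (b : Fn) : Prop :=
  W ∈ tangentLeaf (embQ q) ∧ W - embQ b ∈ distE (embQ q)

/-- The covector `α` of the loop space at `S(q)` vanishes on `D` and restricts on `T𝒬` to the
covector given by `a`. -/
def IsExtension (q a : Fn) (α : Loop) : Prop :=
  (∀ W ∈ distD (embQ q), pairing α W = 0) ∧ ∀ b : Fn, pairing α (embQ b) = pairingQ a b

/-- `R` is the tensor on `𝒬` obtained by reduction of the tensor `P`: it maps a covector `a` to
the projection of `P α`, for the extensions `α` of `a`. -/
def IsReduction (P : Loop → Loop →ₗ[ℝ] Loop) (R : Fn → Fn →ₗ[ℝ] Fn) : Prop :=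
  ∀ q ∈ nonvanishing, ∀ a : Fn,
    (∃ α, IsExtension q a α) ∧
    ∀ α, IsExtension q a α → ProjectsTo q (P (embQ q) α) (R q a)

/-! ### The scalar nonlocal Camassa-Holm hierarchy -/

/-- Multiplication by a function. -/
def mulBy (f : Fn) : Fn →ₗ[ℝ] Fn := LinearMap.mulLeft ℝ f

/-- The first Poisson tensor `2 (2q ∂_x + q_x)` of the Camassa-Holm hierarchy. -/
noncomputable def chP₁ (q : Fn) : Fn →ₗ[ℝ] Fn :=
  (2 : ℝ) • ((2 : ℝ) • (mulBy q ∘ₗ dx.toLinearMap) + mulBy (dx q))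

/-- The second Poisson tensor `2 (-∂_x³ + ∂_x)` of the Camassa-Holm hierarchy. -/
noncomputable def chP₂ (_q : Fn) : Fn →ₗ[ℝ] Fn :=
  (2 : ℝ) • (-(dx.toLinearMap ∘ₗ dx.toLinearMap ∘ₗ dx.toLinearMap) + dx.toLinearMap)

/-- The Riccati equation `h_x + h² = 1/4 - q/(2λ)` of the scalar hierarchy, multiplied by `λ`. -/
def IsScalarRiccatiSolution (q : Fn) (h : ℕ → Fn) : Prop :=
  (series (fun i => dx (h i)) + series h ^ 2) * lam
    = cst (const (1 / 4)) * lam - cst (const (1 / 2) * q)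

/-- The functionals `K_j` (`j ≥ 1`), with differentials `dK_j`, are the nonlocal Camassa-Holm
hierarchy: they are the integrals of the coefficients of the formal solution with `h_0 = 1/2` of
the scalar Riccati equation; they are generated through the Lenard recursion by the Casimir
`-½ ∫ q dx` of the second Poisson tensor; and the flow `q_t = chP₁ dK₂` is the Camassa-Holm
equation `u_t - u_txx = -3uu_x + 2u_x u_xx + u u_xxx` for `q = u - u_xx`. -/
structure IsNonlocalCHHierarchy (K : ℕ → Fn → ℝ) (dK : ℕ → Fn → Fn) : Prop where
  density : ∀ q ∈ nonvanishing, ∃ h : ℕ → Fn, IsScalarRiccatiSolution q h ∧ h 0 = const (1 / 2) ∧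
    (∀ h', IsScalarRiccatiSolution q h' → h' 0 = const (1 / 2) → h' = h) ∧
    ∀ j, 1 ≤ j → K j q = integral (h j)
  start : ∀ q ∈ nonvanishing, K 1 q = -(1 / 2) * integral q
  hierarchy : IsBihamiltonianHierarchy pairingQ nonvanishing chP₁ chP₂ K dK
  camassaHolm : ∀ u : Fn, u - dx (dx u) ∈ nonvanishing →
    chP₁ (u - dx (dx u)) (dK 2 (u - dx (dx u)))
      = -3 * u * dx u + 2 * dx u * dx (dx u) + u * dx (dx (dx u))

/-- The functionals `H_j` on the loop space, with differentials `dH_j`, reduce to the functionals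
`K_j(q)` on `𝒬`, with differentials `dK_j`: they are constant along `E` on `𝒮`, they restrict to
`K_j` on `𝒬`, and at the points of `𝒬` the vector fields `P₁ dH_j = P₂ dH_{j+1}` are tangent to
`𝒮` and project to `chP₁ dK_j = chP₂ dK_{j+1}`. -/
structure ReducesTo (H : ℕ → Loop → ℝ) (dH : ℕ → Loop → Loop) (K : ℕ → Fn → ℝ)
    (dK : ℕ → Fn → Fn) : Prop where
  constant : ∀ j, 1 ≤ j → ∀ S ∈ leaf, ∀ W ∈ distE S, pairing (dH j S) W = 0
  restrict : ∀ j, 1 ≤ j → ∀ q ∈ nonvanishing, K j q = H j (embQ q)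
  tangent : ∀ j, 1 ≤ j → ∀ S ∈ leaf, P₁ S (dH j S) ∈ tangentLeaf S
  project₁ : ∀ j, 1 ≤ j → ∀ q ∈ nonvanishing,
    ProjectsTo q (P₁ (embQ q) (dH j (embQ q))) (chP₁ q (dK j q))
  project₂ : ∀ j, 1 ≤ j → ∀ q ∈ nonvanishing,
    ProjectsTo q (P₂ (embQ q) (dH j (embQ q))) (chP₂ q (dK j q))

end MatrixCH

/-!
The Riccati equation belongs to the linear problem `ψ_x = (A - S/λ) ψ`: it is the equation for
`h = ψ₂_x / ψ₂`. The whole argument is algebra in power series in `X = λ⁻¹` over `C^∞(S¹, ℝ)`, with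
the derivation `seriesDx`, once the operators `∂_x + c` with `c ≠ 0` are known to be invertible on
the circle (`dx_add_smul_bijective`).

The primary object is the slope `k = ψ₁ / ψ₂`. It solves `k_x = (1/2 - q/λ) - 2 (p/λ) k - β k²` with
`β = 1/2 - r/λ` and leading coefficient `1`, an equation that determines its coefficients through
the inverse of `∂_x + 1`, and `h = β k + p/λ` solves the Riccati equation
(`density_isRiccatiSolution`). The solution `c` of `c_x = 2hc - β` with leading coefficient `1/2`,
which needs the inverse of `∂_x - 1`, completes `k` to the resolvent `W = !![a, b; c, -a]` with
`a = ck - 1/2` and `b = k - ck²`; then `W² = 1/4` (`resolvent_sq`) and `W_x = [A - S/λ, W]`. The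
coefficients of `-W/λ` are the gradients `dH_j`. Indeed each coefficient of `h` is polynomial in `t`
along the line `S + tV`, and linearizing the equation for `k` gives
`δh = -(c δk)_x - tr (W δS)/λ` (`exists_velocity_density`), whose integral is the gradient formula
`isGradient_hamiltonian`. The equation for `W_x` is the Lenard recursion (`P₂_gradient_succ`).

For the reduction, at `S(q)` the distributions `D` and `E` are both equal to the set of the loops
`!![f/2, f_x; 0, -f/2]`, so that the projection on `𝒬` takes `!![p, q; 0, -p]` to `q - 2p_x`
(`projectsTo_iff`), and the extensions of `a` are the loops `!![a_x, ·; a, -a_x]`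
(`isExtension_iff`). The reduced tensors follow by substitution. The gradients `dH_j` annihilate
`D` by the Lenard recursion and skew-symmetry (`pairing_gradient_distD`), so that they extend the
gradients of the restricted functionals, and the whole hierarchy projects to `𝒬`. There the Riccati
equation becomes the scalar one (`isScalarRiccatiSolution_iff`).
-/

namespace MatrixCH

open scoped ContDiff

attribute [local instance 100] LieRing.ofAssociativeRing

/-! ### Analysis on the circle -/

theorem Fn.ext {f g : Fn} (h : ∀ x, f.1 x = g.1 x) : f = g := Subtype.ext (funext h)

theorem Fn.hasDerivAt (f : Fn) (x : ℝ) : HasDerivAt f.1 ((dx f).1 x) x :=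
  (f.differentiable x).hasDerivAt

/-- Rolle's theorem on the circle. -/
theorem Fn.exists_dx_eq_zero (f : Fn) : ∃ x, (dx f).1 x = 0 := by
  obtain ⟨x, -, hx⟩ := exists_deriv_eq_zero (f := f.1) one_pos f.2.1.continuous.continuousOn
    (by simpa using (f.2.2 0).symm)
  exact ⟨x, hx⟩

/-- A solution of the linear equation `g' = -(w g)` that vanishes at a point is zero. -/
theorem eq_zero_of_linear_ode {g w : ℝ → ℝ} (hw : Continuous w)
    (hg : ∀ x, HasDerivAt g (-(w x * g x)) x) {x₀ : ℝ} (h₀ : g x₀ = 0) (x : ℝ) : g x = 0 := by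
  -- the integrating factor is the exponential of a primitive of `w`
  have hW : ∀ y, HasDerivAt (fun y => ∫ s in (0 : ℝ)..y, w s) (w y) y := fun y =>
    intervalIntegral.integral_hasDerivAt_right (hw.intervalIntegrable _ _)
      (hw.stronglyMeasurableAtFilter _ _) hw.continuousAt
  have hd : ∀ y, HasDerivAt (fun y => g y * Real.exp (∫ s in (0 : ℝ)..y, w s)) 0 y := fun y =>
    ((hg y).mul (hW y).exp).congr_deriv (by ring)
  have h := is_const_of_deriv_eq_zero (fun y => (hd y).differentiableAt)
    (fun y => (hd y).deriv) x x₀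
  simp only [h₀, zero_mul, mul_eq_zero, Real.exp_ne_zero, or_false] at h
  exact h

theorem dx_add_smul_injective {c : ℝ} (hc : c ≠ 0) {f : Fn} (hf : dx f + c • f = 0) : f = 0 := by
  have hd : ∀ x, HasDerivAt f.1 (-(c * f.1 x)) x := fun x => by
    have h : (dx f).1 x + c * f.1 x = 0 := congrFun (congrArg Subtype.val hf) x
    rw [← eq_neg_of_add_eq_zero_left h]
    exact f.hasDerivAt x
  -- a zero of `dx f` is a zero of `f`
  obtain ⟨x₀, hx₀⟩ := f.exists_dx_eq_zero
  have h : (dx f).1 x₀ + c * f.1 x₀ = 0 := congrFun (congrArg Subtype.val hf) x₀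
  rw [hx₀, zero_add, mul_eq_zero, or_iff_right hc] at h
  exact Fn.ext fun x => eq_zero_of_linear_ode continuous_const hd h x

theorem dx_add_smul_surjective {c : ℝ} (hc : c ≠ 0) (m : Fn) : ∃ f : Fn, dx f + c • f = m := by
  have hexp : ContDiff ℝ ∞ fun s => Real.exp (c * s) * m.1 s :=
    (Real.contDiff_exp.comp (contDiff_const.mul contDiff_id)).mul m.2.1
  have hI : ∀ x, HasDerivAt (fun x => ∫ s in (0 : ℝ)..x, Real.exp (c * s) * m.1 s)
      (Real.exp (c * x) * m.1 x) x := fun x =>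
    intervalIntegral.integral_hasDerivAt_right (hexp.continuous.intervalIntegrable _ _)
      (hexp.continuous.stronglyMeasurableAtFilter _ _) hexp.continuous.continuousAt
  set I : ℝ → ℝ := fun x => ∫ s in (0 : ℝ)..x, Real.exp (c * s) * m.1 s with hIdef
  have hI0 : I 0 = 0 := by simp [hIdef]
  have hIs : ContDiff ℝ ∞ I := contDiff_infty_iff_deriv.2
    ⟨fun x => (hI x).differentiableAt, by rwa [funext fun x => (hI x).deriv]⟩
  -- the constant of integration makes the values at `0` and `1` agree
  set K : ℝ := I 1 / (Real.exp c - 1) with hK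
  have hne : Real.exp c - 1 ≠ 0 := fun h => hc (by
    simpa using (Real.exp_eq_one_iff c).1 (by linarith))
  set F : ℝ → ℝ := fun x => Real.exp (-(c * x)) * (K + I x) with hF
  have hFs : ContDiff ℝ ∞ F :=
    (Real.contDiff_exp.comp (contDiff_const.mul contDiff_id).neg).mul (contDiff_const.add hIs)
  have hFd : ∀ x, HasDerivAt F (m.1 x - c * F x) x := fun x => by
    have h1 : HasDerivAt (fun y : ℝ => -(c * y)) (-(c * 1)) x :=
      ((hasDerivAt_id x).const_mul c).neg
    refine (h1.exp.mul ((hI x).const_add K)).congr_deriv ?_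
    have h2 : Real.exp (-(c * x)) * Real.exp (c * x) = 1 := by
      rw [← Real.exp_add]; simp
    simp only [hF]
    linear_combination m.1 x * h2
  have hF1 : F (0 + 1) = F 0 := by
    have h2 : Real.exp (-c) * Real.exp c = 1 := by rw [← Real.exp_add]; simp
    have h3 : K * (Real.exp c - 1) = I 1 := div_mul_cancel₀ _ hne
    simp only [hF, hI0, zero_add, mul_one, mul_zero, neg_zero, Real.exp_zero, one_mul, add_zero]
    linear_combination K * h2 - Real.exp (-c) * h3
  have hper : Function.Periodic F 1 := fun x => by
    have hd : ∀ y, HasDerivAt (fun y => F (y + 1) - F y) (-(c * (F (y + 1) - F y))) y := fun y =>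
      (((hFd (y + 1)).comp_add_const y 1).sub (hFd y)).congr_deriv (by rw [m.2.2 y]; ring)
    exact sub_eq_zero.1 (eq_zero_of_linear_ode continuous_const hd (sub_eq_zero.2 hF1) x)
  refine ⟨⟨F, hFs, hper⟩, Fn.ext fun x => ?_⟩
  change deriv F x + c * F x = m.1 x
  rw [(hFd x).deriv]; ring

theorem dx_add_smul_bijective {c : ℝ} (hc : c ≠ 0) :
    Function.Bijective (dx.toLinearMap + c • LinearMap.id : Fn →ₗ[ℝ] Fn) :=
  ⟨(injective_iff_map_eq_zero _).2 fun _ hf => dx_add_smul_injective hc hf,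
    fun m => dx_add_smul_surjective hc m⟩

/-- The inverse of `∂_x + c` on `C^∞(S¹, ℝ)`, for a nonzero constant `c`. -/
noncomputable def dxAddInv (c : ℝ) (hc : c ≠ 0) : Fn →ₗ[ℝ] Fn :=
  (LinearEquiv.ofBijective _ (dx_add_smul_bijective hc)).symm.toLinearMap

theorem dxAddInv_spec {c : ℝ} (hc : c ≠ 0) (m : Fn) :
    dx (dxAddInv c hc m) + c • dxAddInv c hc m = m :=
  (LinearEquiv.ofBijective _ (dx_add_smul_bijective hc)).apply_symm_apply m

theorem existsUnique_add_dx (m : Fn) : ∃! f : Fn, f + dx f = m := by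
  have h := (dx_add_smul_bijective (one_ne_zero (α := ℝ))).existsUnique m
  simpa [add_comm] using h

theorem add_dx_injective {f g : Fn} (h : f + dx f = g + dx g) : f = g :=
  (existsUnique_add_dx (g + dx g)).unique h rfl

theorem sub_dx_injective {f g : Fn} (h : f - dx f = g - dx g) : f = g := by
  apply (dx_add_smul_bijective (c := -1) (by norm_num)).1
  change dx f + (-1 : ℝ) • f = dx g + (-1 : ℝ) • g
  rw [neg_one_smul, neg_one_smul]
  linear_combination -h

/-- The constant functions `1/2` and `-1/2` are the only smooth solutions on the circle of the
Riccati equation `f' + f² = 1/4`: if `f` takes neither value then `f' = (1/2 - f)(1/2 + f)` has no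
zero, against Rolle's theorem, and if it takes one then it is constant since `f ∓ 1/2` solves a
linear equation. -/
theorem eq_const_of_riccati {f : Fn} (hf : dx f + f ^ 2 = const (1 / 4)) :
    f = const (1 / 2) ∨ f = const (-(1 / 2)) := by
  have hx : ∀ x, (dx f).1 x + f.1 x ^ 2 = 1 / 4 := fun x =>
    congrFun (congrArg Subtype.val hf) x
  have key : ∀ e : ℝ, e ^ 2 = 1 / 4 → (∃ x, f.1 x - e = 0) → f = const e := by
    rintro e he ⟨x₀, h₀⟩
    refine Fn.ext fun x => sub_eq_zero.1 (eq_zero_of_linear_ode (g := fun x => f.1 x - e)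
      (w := fun x => f.1 x + e) (f.2.1.continuous.add continuous_const) (fun y => ?_) h₀ x)
    exact ((f.hasDerivAt y).sub_const e).congr_deriv (by linear_combination hx y - he)
  obtain ⟨x, h⟩ := f.exists_dx_eq_zero
  have h2 : (f.1 x - 1 / 2) * (f.1 x - -(1 / 2)) = 0 := by linear_combination hx x - h
  rcases mul_eq_zero.1 h2 with h3 | h3
  · exact Or.inl (key _ (by norm_num) ⟨x, h3⟩)
  · exact Or.inr (key _ (by norm_num) ⟨x, h3⟩)

theorem existsUnique_helmholtz (m : Fn) : ∃! γ : Fn, dx (dx γ) - γ = m := by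
  refine ⟨dxAddInv 1 one_ne_zero (dxAddInv (-1) (by norm_num) m), ?_, fun γ hγ => ?_⟩
  · have h1 := dxAddInv_spec (one_ne_zero (α := ℝ)) (dxAddInv (-1) (by norm_num) m)
    have h2 := dxAddInv_spec (c := -1) (by norm_num) m
    have h3 := congrArg dx h1
    simp only [map_add, one_smul, neg_one_smul] at h1 h2 h3
    linear_combination h3 - h1 + h2
  · have h1 := dxAddInv_spec (one_ne_zero (α := ℝ)) (dxAddInv (-1) (by norm_num) m)
    have h2 := dxAddInv_spec (c := -1) (by norm_num) m
    rw [one_smul] at h1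
    rw [neg_one_smul] at h2
    apply add_dx_injective
    apply sub_dx_injective
    rw [add_comm (dxAddInv _ _ _), h1]
    simp only [map_add]
    linear_combination h2 - hγ

/-! ### The integral -/

theorem Fn.intervalIntegrable (f : Fn) :
    IntervalIntegrable f.1 MeasureTheory.volume 0 1 :=
  f.2.1.continuous.intervalIntegrable _ _

/-- The integral over the circle as a linear functional. -/
noncomputable def integralₗ : Fn →ₗ[ℝ] ℝ where
  toFun := integral
  map_add' f g := intervalIntegral.integral_add f.intervalIntegrable g.intervalIntegrable
  map_smul' c f := intervalIntegral.integral_const_mul c f.1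

theorem integral_add (f g : Fn) : integral (f + g) = integral f + integral g :=
  integralₗ.map_add f g

theorem integral_neg (f : Fn) : integral (-f) = -integral f := integralₗ.map_neg f

theorem integral_sub (f g : Fn) : integral (f - g) = integral f - integral g :=
  integralₗ.map_sub f g

theorem integral_smul (c : ℝ) (f : Fn) : integral (c • f) = c * integral f :=
  integralₗ.map_smul c f

theorem integral_zero : integral 0 = 0 := integralₗ.map_zero

theorem integral_dx (f : Fn) : integral (dx f) = 0 := by
  have h := intervalIntegral.integral_eq_sub_of_hasDerivAt
    (fun x (_ : x ∈ Set.uIcc (0 : ℝ) 1) => f.hasDerivAt x) (dx f).intervalIntegrable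
  have h1 : f.1 1 = f.1 0 := by simpa using f.2.2 0
  rw [h1, sub_self] at h
  exact h

/-- Integration by parts: the primitive `w` of the difference of the integrands is to be given. -/
theorem integral_eq_of_sub_eq_dx {f g : Fn} (w : Fn) (h : f - g = dx w) :
    integral f = integral g := by
  rw [← sub_eq_zero, ← integral_sub, h, integral_dx]

/-- The `L²` form is nondegenerate. -/
theorem eq_zero_of_integral_mul {f : Fn} (h : ∀ g : Fn, integral (f * g) = 0) : f = 0 := by
  have h0 : ∫ x in (0 : ℝ)..1, f.1 x * f.1 x = 0 := h f
  have hc : Continuous fun x => f.1 x * f.1 x := f.2.1.continuous.mul f.2.1.continuous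
  have h1 : ∀ x ∈ Set.Icc (0 : ℝ) 1, f.1 x = 0 := by
    by_contra! hne
    obtain ⟨x, hx, hfx⟩ := hne
    have := intervalIntegral.integral_pos (a := (0 : ℝ)) (b := 1) one_pos hc.continuousOn
      (fun y _ => mul_self_nonneg _) ⟨x, hx, mul_self_pos.2 hfx⟩
    exact this.ne' h0
  refine Fn.ext fun x => ?_
  have hper : Function.Periodic f.1 1 := f.2.2
  obtain ⟨y, hy, hxy⟩ := hper.exists_mem_Ico₀ one_pos x
  rw [hxy]
  exact h1 y ⟨hy.1, hy.2.le⟩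

/-! ### Formal series in `λ⁻¹` -/

open PowerSeries

/-- The derivation `∂_x` of the formal series in `X = λ⁻¹`, applied to each coefficient. -/
noncomputable def seriesDx : Derivation ℤ Fn⟦X⟧ Fn⟦X⟧ :=
  Derivation.mk'
    (AddMonoidHom.mk' (fun f => PowerSeries.mk fun n => dx (coeff n f))
      (fun f g => by ext1 n; simp)).toIntLinearMap
    (fun f g => by
      change PowerSeries.mk (fun n => dx (coeff n (f * g)))
        = f • PowerSeries.mk (fun n => dx (coeff n g)) + g • PowerSeries.mk fun n => dx (coeff n f)
      ext1 n
      simp only [coeff_mk, coeff_mul, map_sum, map_add,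
        Derivation.leibniz, smul_eq_mul, Finset.sum_add_distrib]
      congr 1
      rw [← Finset.Nat.sum_antidiagonal_swap]
      rfl)

theorem coeff_seriesDx (f : Fn⟦X⟧) (n : ℕ) : coeff n (seriesDx f) = dx (coeff n f) :=
  coeff_mk n fun n => dx (coeff n f)

theorem seriesDx_C (f : Fn) : seriesDx (C f) = C (dx f) := by
  ext1 n
  rw [coeff_seriesDx, coeff_C, coeff_C]
  split_ifs <;> simp

theorem seriesDx_X : seriesDx (X : Fn⟦X⟧) = 0 := by
  ext1 n
  rw [coeff_seriesDx, coeff_X]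
  split_ifs <;> simp

theorem seriesDx_mk (h : ℕ → Fn) :
    seriesDx (PowerSeries.mk h) = PowerSeries.mk fun i => dx (h i) := by
  ext1 n
  rw [coeff_seriesDx, coeff_mk, coeff_mk]

theorem dx_const (c : ℝ) : dx (const c) = 0 := dx.map_algebraMap c

theorem dx_two : dx (2 : Fn) = 0 := dx.map_natCast 2

theorem dx_four : dx (4 : Fn) = 0 := dx.map_natCast 4

theorem two_mul_const_half : 2 * const (1 / 2) = 1 :=
  Fn.ext fun x => by change (2 : ℝ) * (1 / 2) = 1; norm_num

theorem const_quarter : const (1 / 4) = const (1 / 2) ^ 2 :=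
  Fn.ext fun x => by change (1 / 4 : ℝ) = (1 / 2) ^ 2; norm_num

theorem smul_eq_const_mul (c : ℝ) (f : Fn) : c • f = const c * f := Algebra.smul_def c f

/-- `1/2`, as a constant formal series. -/
noncomputable def half : Fn⟦X⟧ := C (const (1 / 2))

theorem two_mul_half : 2 * half = 1 := by
  rw [half, ← map_ofNat (C : Fn →+* Fn⟦X⟧) 2, ← map_mul, two_mul_const_half, map_one]

theorem seriesDx_half : seriesDx half = 0 := by
  rw [half, seriesDx_C, dx_const, map_zero]

/-! ### Recursive equations for formal series -/

/-- The coefficients of `Φ m` of index at most `N` are determined by the coefficients of `m` of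
index below `N`. -/
def IsContracting (Φ : Fn⟦X⟧ → Fn⟦X⟧) : Prop :=
  ∀ m m' N, X ^ N ∣ m - m' → X ^ (N + 1) ∣ Φ m - Φ m'

/-- The successive approximations of the solution of the equation `m = J (Φ m)`, where `J` is
applied to each coefficient. -/
noncomputable def approx (J : Fn → Fn) (Φ : Fn⟦X⟧ → Fn⟦X⟧) : ℕ → Fn⟦X⟧
  | 0 => 0
  | N + 1 => PowerSeries.mk fun n => J (coeff n (Φ (approx J Φ N)))

/-- The formal series whose coefficients are the stable coefficients of the approximations. -/
noncomputable def formalFix (J : Fn → Fn) (Φ : Fn⟦X⟧ → Fn⟦X⟧) : Fn⟦X⟧ :=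
  PowerSeries.mk fun n => coeff n (approx J Φ (n + 1))

theorem coeff_eq_of_dvd_sub {m m' : Fn⟦X⟧} {N n : ℕ} (h : X ^ N ∣ m - m') (hn : n < N) :
    coeff n m = coeff n m' := by
  rw [← sub_eq_zero, ← map_sub]
  exact X_pow_dvd_iff.1 h n hn

/-- `formalFix J Φ` solves the equation `m = J (Φ m)`. -/
theorem coeff_formalFix (J : Fn → Fn) {Φ : Fn⟦X⟧ → Fn⟦X⟧} (hΦ : IsContracting Φ) (n : ℕ) :
    coeff n (formalFix J Φ) = J (coeff n (Φ (formalFix J Φ))) := by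
  have hstep : ∀ N, X ^ N ∣ approx J Φ (N + 1) - approx J Φ N := by
    intro N
    induction N with
    | zero => simp
    | succ N ih =>
      refine X_pow_dvd_iff.2 fun i hi => ?_
      rw [map_sub, sub_eq_zero, approx, coeff_mk]
      conv_rhs => rw [approx, coeff_mk]
      rw [coeff_eq_of_dvd_sub (hΦ _ _ _ ih) hi]
  have hstable : ∀ N i, i < N → coeff i (approx J Φ N) = coeff i (formalFix J Φ) := by
    intro N
    induction N with
    | zero => intro i hi; omega
    | succ N ih =>
      intro i hi
      rcases Nat.lt_succ_iff_lt_or_eq.1 hi with h | rfl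
      · rw [coeff_eq_of_dvd_sub (hstep N) h, ih i h]
      · rw [formalFix, coeff_mk]
  conv_lhs => rw [formalFix, coeff_mk, approx, coeff_mk]
  rw [coeff_eq_of_dvd_sub (hΦ _ _ n (X_pow_dvd_iff.2 fun i hi => ?_)) n.lt_succ_self]
  rw [map_sub, sub_eq_zero]
  exact hstable n i hi

/-! ### Polynomial curves -/

/-- `f` is a polynomial curve in `C^∞(S¹, ℝ)`, and `g` is its velocity at time `0`. -/
def HasVelocity (f : ℝ → Fn) (g : Fn) : Prop :=
  ∃ R : Polynomial Fn, (∀ t, f t = R.eval (const t)) ∧ R.coeff 1 = g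

namespace HasVelocity

theorem of_eq {f : ℝ → Fn} {g g' : Fn} (h : HasVelocity f g) (e : g = g') : HasVelocity f g' :=
  e ▸ h

theorem constant (a : Fn) : HasVelocity (fun _ => a) 0 :=
  ⟨Polynomial.C a, fun t => by simp, by simp⟩

theorem line (a b : Fn) : HasVelocity (fun t => a + t • b) b := by
  refine ⟨Polynomial.C a + Polynomial.C b * Polynomial.X, fun t => ?_, ?_⟩
  · simp only [Polynomial.eval_add, Polynomial.eval_mul, Polynomial.eval_C, Polynomial.eval_X]
    rw [smul_eq_const_mul, mul_comm]
  · simp only [Polynomial.coeff_add, Polynomial.coeff_C_mul, Polynomial.coeff_X_one, mul_one,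
      Polynomial.coeff_C_of_ne_zero one_ne_zero, zero_add]

theorem add {f f' : ℝ → Fn} {g g' : Fn} (h : HasVelocity f g) (h' : HasVelocity f' g') :
    HasVelocity (fun t => f t + f' t) (g + g') := by
  obtain ⟨R, hR, rfl⟩ := h
  obtain ⟨R', hR', rfl⟩ := h'
  exact ⟨R + R', fun t => by simp only [hR, hR', Polynomial.eval_add], Polynomial.coeff_add _ _ _⟩

theorem mul {f f' : ℝ → Fn} {g g' : Fn} (h : HasVelocity f g) (h' : HasVelocity f' g') :
    HasVelocity (fun t => f t * f' t) (f 0 * g' + g * f' 0) := by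
  obtain ⟨R, hR, rfl⟩ := h
  obtain ⟨R', hR', rfl⟩ := h'
  have h0 : const 0 = 0 := map_zero (algebraMap ℝ Fn)
  refine ⟨R * R', fun t => by simp only [hR, hR', Polynomial.eval_mul], ?_⟩
  rw [Polynomial.mul_coeff_one, hR, hR', h0, ← Polynomial.coeff_zero_eq_eval_zero,
    ← Polynomial.coeff_zero_eq_eval_zero]

theorem sum {ι : Type} (s : Finset ι) {f : ι → ℝ → Fn} {g : ι → Fn}
    (h : ∀ i ∈ s, HasVelocity (f i) (g i)) :
    HasVelocity (fun t => ∑ i ∈ s, f i t) (∑ i ∈ s, g i) := by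
  classical
  induction s using Finset.induction_on with
  | empty => simpa using constant 0
  | insert i s hi ih =>
    simp only [Finset.sum_insert hi]
    exact (h i (Finset.mem_insert_self i s)).add
      (ih fun j hj => h j (Finset.mem_insert_of_mem hj))

theorem map_eval (R : Polynomial Fn) {M : Type} [AddCommGroup M] [Module ℝ M] (L : Fn →ₗ[ℝ] M)
    (t : ℝ) :
    L (R.eval (const t)) = ∑ i ∈ Finset.range (R.natDegree + 1), t ^ i • L (R.coeff i) := by
  rw [Polynomial.eval_eq_sum_range, map_sum]
  refine Finset.sum_congr rfl fun i _ => ?_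
  rw [const, ← map_pow, mul_comm, ← Algebra.smul_def, map_smul]

theorem map {f : ℝ → Fn} {g : Fn} (L : Fn →ₗ[ℝ] Fn) (h : HasVelocity f g) :
    HasVelocity (fun t => L (f t)) (L g) := by
  obtain ⟨R, hR, rfl⟩ := h
  refine ⟨∑ i ∈ Finset.range (R.natDegree + 1), Polynomial.monomial i (L (R.coeff i)),
    fun t => ?_, ?_⟩
  · simp only [hR, map_eval, Polynomial.eval_finsetSum]
    refine Finset.sum_congr rfl fun i _ => ?_
    rw [Polynomial.eval_monomial, const, ← map_pow, mul_comm, ← Algebra.smul_def]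
  · simp only [Polynomial.finsetSum_coeff, Polynomial.coeff_monomial, Finset.sum_ite_eq',
      Finset.mem_range]
    split_ifs with h1
    · rfl
    · rw [Polynomial.coeff_eq_zero_of_natDegree_lt (by omega), map_zero]

theorem hasDerivAt {f : ℝ → Fn} {g : Fn} (ℓ : Fn →ₗ[ℝ] ℝ) (h : HasVelocity f g) :
    HasDerivAt (fun t => ℓ (f t)) (ℓ g) 0 := by
  obtain ⟨R, hR, rfl⟩ := h
  set Q : Polynomial ℝ :=
    ∑ i ∈ Finset.range (R.natDegree + 1), Polynomial.monomial i (ℓ (R.coeff i)) with hQ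
  have h1 : (fun t => ℓ (f t)) = fun t => Q.eval t := by
    funext t
    rw [hR, map_eval, hQ, Polynomial.eval_finsetSum]
    refine Finset.sum_congr rfl fun i _ => ?_
    rw [Polynomial.eval_monomial, mul_comm, smul_eq_mul]
  have h2 : Q.derivative.eval 0 = ℓ (R.coeff 1) := by
    rw [← Polynomial.coeff_zero_eq_eval_zero, Polynomial.coeff_derivative, hQ]
    simp only [Polynomial.finsetSum_coeff, Polynomial.coeff_monomial, Finset.sum_ite_eq',
      Finset.mem_range]
    split_ifs with h3
    · simp
    · rw [Polynomial.coeff_eq_zero_of_natDegree_lt (by omega), map_zero]; simp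
  rw [h1, ← h2]
  exact Q.hasDerivAt 0

theorem unique {f : ℝ → Fn} {g g' : Fn} (h : HasVelocity f g) (h' : HasVelocity f g') :
    g = g' := by
  refine Fn.ext fun x => ?_
  let ev : Fn →ₗ[ℝ] ℝ := (LinearMap.proj x).comp smoothCircle.val.toLinearMap
  exact (h.hasDerivAt ev).unique (h'.hasDerivAt ev)

end HasVelocity

/-- `F` is a curve of formal series with polynomial coefficients, and `G` is its velocity at time
`0`. -/
def HasSeriesVelocity (F : ℝ → Fn⟦X⟧) (G : Fn⟦X⟧) : Prop :=
  ∀ n, HasVelocity (fun t => coeff n (F t)) (coeff n G)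

namespace HasSeriesVelocity

theorem of_eq {F : ℝ → Fn⟦X⟧} {G G' : Fn⟦X⟧} (h : HasSeriesVelocity F G) (e : G = G') :
    HasSeriesVelocity F G' := e ▸ h

theorem constant (F : Fn⟦X⟧) : HasSeriesVelocity (fun _ => F) 0 :=
  fun _ => (HasVelocity.constant _).of_eq (map_zero _).symm

theorem C_line (a b : Fn) : HasSeriesVelocity (fun t => C (a + t • b)) (C b) := by
  intro n
  simp only [coeff_C]
  split_ifs
  · exact HasVelocity.line a b
  · exact HasVelocity.constant 0

theorem add {F F' : ℝ → Fn⟦X⟧} {G G' : Fn⟦X⟧} (h : HasSeriesVelocity F G)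
    (h' : HasSeriesVelocity F' G') : HasSeriesVelocity (fun t => F t + F' t) (G + G') := fun n => by
  simp only [map_add]
  exact (h n).add (h' n)

theorem mul {F F' : ℝ → Fn⟦X⟧} {G G' : Fn⟦X⟧} (h : HasSeriesVelocity F G)
    (h' : HasSeriesVelocity F' G') :
    HasSeriesVelocity (fun t => F t * F' t) (F 0 * G' + G * F' 0) := fun n => by
  simp only [map_add, coeff_mul, ← Finset.sum_add_distrib]
  exact HasVelocity.sum _ fun i _ => (h i.1).mul (h' i.2)

theorem neg {F : ℝ → Fn⟦X⟧} {G : Fn⟦X⟧} (h : HasSeriesVelocity F G) :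
    HasSeriesVelocity (fun t => -F t) (-G) := fun n => by
  simp only [map_neg]
  exact (h n).map (-LinearMap.id)

theorem sub {F F' : ℝ → Fn⟦X⟧} {G G' : Fn⟦X⟧} (h : HasSeriesVelocity F G)
    (h' : HasSeriesVelocity F' G') : HasSeriesVelocity (fun t => F t - F' t) (G - G') := by
  simp only [sub_eq_add_neg]
  exact h.add h'.neg

theorem seriesDx {F : ℝ → Fn⟦X⟧} {G : Fn⟦X⟧} (h : HasSeriesVelocity F G) :
    HasSeriesVelocity (fun t => MatrixCH.seriesDx (F t)) (MatrixCH.seriesDx G) := fun n => by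
  simp only [coeff_seriesDx]
  exact (h n).map dx.toLinearMap

theorem unique {F : ℝ → Fn⟦X⟧} {G G' : Fn⟦X⟧} (h : HasSeriesVelocity F G)
    (h' : HasSeriesVelocity F G') : G = G' := by
  ext1 n
  exact (h n).unique (h' n)

end HasSeriesVelocity

/-- The solution of a recursive equation with coefficients polynomial in `t` has coefficients
polynomial in `t`. -/
theorem exists_velocity_formalFix (J : Fn →ₗ[ℝ] Fn) {Φ : ℝ → Fn⟦X⟧ → Fn⟦X⟧}
    (hΦ : ∀ F G, HasSeriesVelocity F G → ∃ G', HasSeriesVelocity (fun t => Φ t (F t)) G') :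
    ∃ G, HasSeriesVelocity (fun t => formalFix J (Φ t)) G := by
  have h : ∀ N, ∃ G, HasSeriesVelocity (fun t => approx J (Φ t) N) G := by
    intro N
    induction N with
    | zero => exact ⟨0, HasSeriesVelocity.constant 0⟩
    | succ N ih =>
      obtain ⟨G, hG⟩ := ih
      obtain ⟨G', hG'⟩ := hΦ _ _ hG
      refine ⟨PowerSeries.mk fun n => J (coeff n G'), fun n => ?_⟩
      simp only [approx, coeff_mk]
      exact (hG' n).map J
  choose G hG using h
  refine ⟨PowerSeries.mk fun n => coeff n (G (n + 1)), fun n => ?_⟩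
  simp only [formalFix, coeff_mk]
  exact hG (n + 1) n

/-! ### The Riccati equation as an equation between power series -/

/-- Multiplication by the cube of the inverse of `l` turns the Riccati equation into an equation
without negative powers of `x`. -/
theorem clear_parameter {R : Type} [CommRing R] {l x : R} (hl : l * x = 1)
    (A r s s' a c₀ c₁ c₂ : R) :
    A * (2 * r - l) * l ^ 2 - 2 * s' * s * l ^ 2 = -(a * l ^ 3) + c₀ * l ^ 2 + c₁ * l + c₂ ↔
      A * (2 * r * x - 1) - 2 * s' * s * x = -a + c₀ * x + c₁ * x ^ 2 + c₂ * x ^ 3 := by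
  have h2 : l ^ 2 * x ^ 2 = 1 := by linear_combination (l * x + 1) * hl
  have h3 : l ^ 3 * x ^ 3 = 1 := by linear_combination (l ^ 2 * x ^ 2 + l * x + 1) * hl
  constructor <;> intro h
  · linear_combination x ^ 3 * h + (A - a) * h3
      + (-2 * r * A * x + 2 * s' * s * x + c₀ * x) * h2 + c₁ * x ^ 2 * hl
  · linear_combination l ^ 3 * h - (2 * r * A * l ^ 2 - 2 * s' * s * l ^ 2 - c₀ * l ^ 2) * hl
      + c₁ * l * h2 + c₂ * h3

theorem ofPowerSeries_injective :
    Function.Injective (HahnSeries.ofPowerSeries ℤ Fn) := HahnSeries.ofPowerSeries_injective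

theorem lam_mul_ofPowerSeries_X : lam * HahnSeries.ofPowerSeries ℤ Fn X = 1 := by
  rw [lam, HahnSeries.ofPowerSeries_X, HahnSeries.single_mul_single]
  simp

theorem cst_eq (f : Fn) : cst f = HahnSeries.ofPowerSeries ℤ Fn (C f) :=
  (HahnSeries.ofPowerSeries_C f).symm

/-- The Riccati equation, divided by `λ³`. -/
theorem isRiccatiSolution_iff_powerSeries (S : Loop) (h : ℕ → Fn) :
    IsRiccatiSolution S h ↔
      (seriesDx (PowerSeries.mk h) + PowerSeries.mk h ^ 2) * (2 * C (rOf S) * X - 1)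
          - 2 * C (dx (rOf S)) * PowerSeries.mk h * X
        = -C (const (1 / 4)) + C (riccatiCoeff S 0) * X + C (riccatiCoeff S 1) * X ^ 2
          + C (riccatiCoeff S 2) * X ^ 3 := by
  rw [← ofPowerSeries_injective.eq_iff, IsRiccatiSolution]
  simp only [map_add, map_sub, map_mul, map_pow, map_neg, map_one, map_ofNat]
  rw [seriesDx_mk, ← clear_parameter lam_mul_ofPowerSeries_X]
  simp only [← cst_eq, series]
  rfl

/-- On `𝒬` the matrix Riccati equation is `-λ²` times the scalar one. -/
theorem isScalarRiccatiSolution_iff (q : Fn) (h : ℕ → Fn) :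
    IsScalarRiccatiSolution q h ↔ IsRiccatiSolution (embQ q) h := by
  have hp : pOf (embQ q) = 0 := rfl
  have hq : qOf (embQ q) = q := rfl
  have hr : rOf (embQ q) = 0 := rfl
  have hl := lam_mul_ofPowerSeries_X
  have hc0 : cst 0 = 0 := map_zero _
  rw [IsScalarRiccatiSolution, IsRiccatiSolution, hp, hq, hr]
  simp only [map_zero, hc0, mul_zero, zero_mul, zero_add, sub_zero, zero_sub, add_zero, ne_eq,
    OfNat.ofNat_ne_zero, not_false_eq_true, zero_pow, neg_zero]
  set x := HahnSeries.ofPowerSeries ℤ Fn X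
  have h2 : lam ^ 2 * x ^ 2 = 1 := by linear_combination (lam * x + 1) * hl
  constructor <;> intro e
  · linear_combination -lam ^ 2 * e
  · linear_combination -x ^ 2 * e
      - (((series fun i => dx (h i)) + series h ^ 2) * lam - cst (const (1 / 4)) * lam
        + cst (const (1 / 2) * q)) * h2

theorem coeff_succ_mk_sq (h : ℕ → Fn) (i : ℕ) :
    coeff (i + 1) (PowerSeries.mk h ^ 2)
      = 2 * h 0 * h (i + 1) + ∑ j ∈ Finset.range i, h (j + 1) * h (i - j) := by
  rw [sq, coeff_mul, Finset.Nat.sum_antidiagonal_eq_sum_range_succ_mk, Finset.sum_range_succ,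
    Finset.sum_range_succ']
  simp only [coeff_mk, Nat.add_sub_add_right, Nat.sub_self, Nat.sub_zero]
  ring

theorem coeff_mk_sq (h : ℕ → Fn) (i : ℕ) :
    coeff i (PowerSeries.mk h ^ 2) = ∑ j ∈ Finset.range (i + 1), h j * h (i - j) := by
  rw [sq, coeff_mul, Finset.Nat.sum_antidiagonal_eq_sum_range_succ_mk]
  simp only [coeff_mk]

theorem coeff_succ_riccatiRhs (S : Loop) (i : ℕ) :
    coeff (i + 1) (-C (const (1 / 4)) + C (riccatiCoeff S 0) * X + C (riccatiCoeff S 1) * X ^ 2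
      + C (riccatiCoeff S 2) * X ^ 3 : Fn⟦X⟧) = riccatiCoeff S i := by
  have e : (-C (const (1 / 4)) + C (riccatiCoeff S 0) * X + C (riccatiCoeff S 1) * X ^ 2
      + C (riccatiCoeff S 2) * X ^ 3 : Fn⟦X⟧) = -C (const (1 / 4)) + X * (C (riccatiCoeff S 0)
      + X * (C (riccatiCoeff S 1) + X * C (riccatiCoeff S 2))) := by ring
  rw [e, map_add, coeff_succ_X_mul, map_neg, coeff_succ_C, neg_zero, zero_add]
  rcases i with _ | _ | _ | i
  · simp
  · rw [map_add, coeff_succ_X_mul, coeff_succ_C]; simp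
  · rw [map_add, coeff_succ_X_mul, coeff_succ_C, map_add, coeff_succ_X_mul, coeff_succ_C]; simp
  · rw [map_add, coeff_succ_X_mul, coeff_succ_C, map_add, coeff_succ_X_mul, coeff_succ_C,
      coeff_succ_C]
    simp [riccatiCoeff]

theorem coeff_succ_riccatiLhs (S : Loop) (h : ℕ → Fn) (i : ℕ) :
    coeff (i + 1) ((seriesDx (PowerSeries.mk h) + PowerSeries.mk h ^ 2) * (2 * C (rOf S) * X - 1)
        - 2 * C (dx (rOf S)) * PowerSeries.mk h * X)
      = 2 * rOf S * (dx (h i) + ∑ j ∈ Finset.range (i + 1), h j * h (i - j))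
        - (dx (h (i + 1)) + (2 * h 0 * h (i + 1) + ∑ j ∈ Finset.range i, h (j + 1) * h (i - j)))
        - 2 * dx (rOf S) * h i := by
  have e : (seriesDx (PowerSeries.mk h) + PowerSeries.mk h ^ 2) * (2 * C (rOf S) * X - 1)
        - 2 * C (dx (rOf S)) * PowerSeries.mk h * X
      = X * (C (2 * rOf S) * (seriesDx (PowerSeries.mk h) + PowerSeries.mk h ^ 2))
        - (seriesDx (PowerSeries.mk h) + PowerSeries.mk h ^ 2)
        - X * (C (2 * dx (rOf S)) * PowerSeries.mk h) := by
    rw [map_mul, map_mul, map_ofNat]; ring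
  rw [e, map_sub, map_sub, coeff_succ_X_mul, coeff_succ_X_mul, coeff_C_mul, coeff_C_mul, map_add,
    map_add, coeff_seriesDx, coeff_seriesDx, coeff_succ_mk_sq, coeff_mk_sq, coeff_mk, coeff_mk]

theorem coeff_zero_riccati (S : Loop) (h : ℕ → Fn) :
    coeff 0 ((seriesDx (PowerSeries.mk h) + PowerSeries.mk h ^ 2) * (2 * C (rOf S) * X - 1)
        - 2 * C (dx (rOf S)) * PowerSeries.mk h * X) = -(dx (h 0) + h 0 ^ 2) ∧
    coeff 0 (-C (const (1 / 4)) + C (riccatiCoeff S 0) * X + C (riccatiCoeff S 1) * X ^ 2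
      + C (riccatiCoeff S 2) * X ^ 3 : Fn⟦X⟧) = -const (1 / 4) := by
  have e : constantCoeff (seriesDx (PowerSeries.mk h)) = dx (h 0) := by
    rw [← coeff_zero_eq_constantCoeff_apply, coeff_seriesDx, coeff_mk]
  have e' : constantCoeff (PowerSeries.mk h) = h 0 := by
    rw [← coeff_zero_eq_constantCoeff_apply, coeff_mk]
  constructor
  · rw [coeff_zero_eq_constantCoeff_apply]
    simp only [map_sub, map_mul, map_add, map_pow, constantCoeff_X, e, e', map_one]
    ring
  · rw [coeff_zero_eq_constantCoeff_apply]
    simp only [map_neg, map_mul, map_add, map_pow, constantCoeff_X, constantCoeff_C]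
    ring

theorem IsRiccatiSolution.leading {S : Loop} {h : ℕ → Fn} (hh : IsRiccatiSolution S h) :
    h 0 = const (1 / 2) ∨ h 0 = const (-(1 / 2)) := by
  have h0 := congrArg (coeff 0) ((isRiccatiSolution_iff_powerSeries S h).1 hh)
  rw [(coeff_zero_riccati S h).1, (coeff_zero_riccati S h).2] at h0
  exact eq_const_of_riccati (neg_injective h0)

theorem isRiccatiSolution_iff_recursion (S : Loop) (h : ℕ → Fn) (h0 : h 0 = const (1 / 2)) :
    IsRiccatiSolution S h ↔ ∀ i : ℕ, h (i + 1) + dx (h (i + 1)) = riccatiSource S h i := by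
  rw [isRiccatiSolution_iff_powerSeries, PowerSeries.ext_iff]
  have step : ∀ i, coeff (i + 1) ((seriesDx (PowerSeries.mk h) + PowerSeries.mk h ^ 2)
        * (2 * C (rOf S) * X - 1) - 2 * C (dx (rOf S)) * PowerSeries.mk h * X)
      = coeff (i + 1) (-C (const (1 / 4)) + C (riccatiCoeff S 0) * X
        + C (riccatiCoeff S 1) * X ^ 2 + C (riccatiCoeff S 2) * X ^ 3 : Fn⟦X⟧) ↔
      h (i + 1) + dx (h (i + 1)) = riccatiSource S h i := by
    intro i
    rw [coeff_succ_riccatiLhs, coeff_succ_riccatiRhs, h0, two_mul_const_half, one_mul,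
      riccatiSource]
    constructor <;> intro e <;> linear_combination -e
  refine ⟨fun e i => (step i).1 (e (i + 1)), fun e n => ?_⟩
  cases n with
  | zero =>
    rw [(coeff_zero_riccati S h).1, (coeff_zero_riccati S h).2, h0, dx_const, const_quarter,
      zero_add]
  | succ i => exact (step i).2 (e i)

theorem IsRiccatiSolution.unique {S : Loop} {h h' : ℕ → Fn} (hh : IsRiccatiSolution S h)
    (hh' : IsRiccatiSolution S h') (h0 : h 0 = const (1 / 2)) (h0' : h' 0 = const (1 / 2)) :
    h' = h := by
  funext n
  induction n using Nat.strong_induction_on with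
  | _ n ih =>
    cases n with
    | zero => rw [h0, h0']
    | succ i =>
      have h1 : ∑ j ∈ Finset.range (i + 1), h' j * h' (i - j)
          = ∑ j ∈ Finset.range (i + 1), h j * h (i - j) :=
        Finset.sum_congr rfl fun j hj => by
          rw [ih j (Finset.mem_range.1 hj), ih (i - j) (by omega)]
      have h2 : ∑ j ∈ Finset.range i, h' (j + 1) * h' (i - j)
          = ∑ j ∈ Finset.range i, h (j + 1) * h (i - j) :=
        Finset.sum_congr rfl fun j hj => by
          have := Finset.mem_range.1 hj
          rw [ih (j + 1) (by omega), ih (i - j) (by omega)]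
      apply add_dx_injective
      rw [(isRiccatiSolution_iff_recursion S h h0).1 hh,
        (isRiccatiSolution_iff_recursion S h' h0').1 hh', riccatiSource, riccatiSource,
        ih i i.lt_succ_self, h1, h2]

/-! ### The formal solution and the resolvent -/

/-- The entry `1/2 - r/λ` of the matrix `A - S/λ` of the linear problem. -/
noncomputable def lowerEntry (S : Loop) : Fn⟦X⟧ := half - C (rOf S) * X

/-- The right-hand side of the equation `m_x + m = …` for `m`, where `k = 1 + m/λ` is the slope of
the eigenline. -/
noncomputable def slopeSource (S : Loop) (m : Fn⟦X⟧) : Fn⟦X⟧ :=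
  C (rOf S) * (1 + X * m) ^ 2 - C (qOf S) - 2 * C (pOf S) * (1 + X * m) - half * X * m ^ 2

/-- The slope `k = ψ₁/ψ₂` of the formal solution `ψ` of `ψ_x = (A - S/λ) ψ` that grows
like `exp (x/2)`. -/
noncomputable def slope (S : Loop) : Fn⟦X⟧ :=
  1 + X * formalFix (dxAddInv 1 one_ne_zero) (slopeSource S)

theorem slopeSource_contracting (S : Loop) : IsContracting (slopeSource S) := by
  rintro m m' N ⟨d, hd⟩
  refine ⟨d * (C (rOf S) * (2 + X * m + X * m') - 2 * C (pOf S) - half * (m + m')), ?_⟩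
  rw [slopeSource, slopeSource]
  linear_combination
    (C (rOf S) * (2 + X * m + X * m') - 2 * C (pOf S) - half * (m + m')) * X * hd

theorem seriesDx_slope (S : Loop) :
    seriesDx (slope S) = half - C (qOf S) * X - 2 * C (pOf S) * X * slope S
      - lowerEntry S * slope S ^ 2 := by
  set m := formalFix (dxAddInv 1 one_ne_zero) (slopeSource S) with hm
  have h : seriesDx m + m = slopeSource S m := by
    ext1 n
    rw [map_add, coeff_seriesDx, hm, coeff_formalFix _ (slopeSource_contracting S), ← hm]
    simpa using dxAddInv_spec one_ne_zero (coeff n (slopeSource S m))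
  rw [slopeSource] at h
  rw [slope, ← hm, lowerEntry]
  simp only [map_add, Derivation.leibniz, seriesDx_X, smul_eq_mul, Derivation.map_one_eq_zero]
  linear_combination X * h + X * m * two_mul_half

theorem coeff_zero_slope (S : Loop) : coeff 0 (slope S) = 1 := by
  simp [slope]

/-- The logarithmic derivative `h = ψ₂_x/ψ₂` of the second component of the formal solution of the
linear problem. -/
noncomputable def density (S : Loop) : Fn⟦X⟧ := lowerEntry S * slope S + C (pOf S) * X

theorem seriesDx_lowerEntry (S : Loop) : seriesDx (lowerEntry S) = -(C (dx (rOf S)) * X) := by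
  rw [lowerEntry]
  simp only [map_sub, Derivation.leibniz, seriesDx_X, seriesDx_half, seriesDx_C, smul_eq_mul]
  ring

theorem density_isRiccatiSolution (S : Loop) :
    IsRiccatiSolution S fun i => coeff i (density S) := by
  rw [isRiccatiSolution_iff_powerSeries]
  have e : (PowerSeries.mk fun i => coeff i (density S)) = density S := by ext1; simp
  rw [e, density]
  simp only [map_add, Derivation.leibniz, seriesDx_X, seriesDx_C, seriesDx_lowerEntry,
    seriesDx_slope, smul_eq_mul]
  simp only [riccatiCoeff, lowerEntry, map_add, map_sub, map_neg, map_mul, map_pow, map_ofNat,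
    const_quarter]
  rw [show C (const (1 / 2)) = half from rfl]
  set u := half
  have hu : 2 * u = 1 := two_mul_half
  generalize C (rOf S) = r, C (pOf S) = p, C (qOf S) = q, C (dx (rOf S)) = r', C (dx (pOf S)) = p',
    slope S = k
  linear_combination (-r' * X * k + (u - r * X) * (u - q * X) + p' * X + p ^ 2 * X ^ 2
    + (-u ^ 2 + (u * q + (2 * u + 1) * r - p') * X + (-r ^ 2 - 2 * q * r - p ^ 2) * X ^ 2)) * hu

theorem coeff_zero_density (S : Loop) : coeff 0 (density S) = const (1 / 2) := by
  rw [density, lowerEntry, coeff_zero_eq_constantCoeff_apply]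
  have h := coeff_zero_slope S
  rw [coeff_zero_eq_constantCoeff_apply] at h
  simp [h, half]

/-- The right-hand side of the equation `e_x - e = …` for `e`, where `c = 1/2 + e/λ` is the lower
left entry of the resolvent. -/
noncomputable def resolventSource (S : Loop) (g e : Fn⟦X⟧) : Fn⟦X⟧ :=
  g + C (rOf S) + 2 * X * g * e

/-- The series `g` with `density S = 1/2 + X * g`. -/
noncomputable def densityTail (S : Loop) : Fn⟦X⟧ :=
  PowerSeries.mk fun n => coeff (n + 1) (density S)

theorem density_eq (S : Loop) : density S = half + X * densityTail S := by
  ext1 n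
  cases n with
  | zero => rw [coeff_zero_density]; simp [half]
  | succ n => rw [map_add, coeff_succ_X_mul, half, coeff_succ_C, densityTail, coeff_mk, zero_add]

/-- The lower left entry `c` of the resolvent, the solution of `c_x = 2hc - (1/2 - r/λ)`. -/
noncomputable def resC (S : Loop) : Fn⟦X⟧ :=
  half + X * formalFix (dxAddInv (-1) (by norm_num)) (resolventSource S (densityTail S))

theorem resolventSource_contracting (S : Loop) (g : Fn⟦X⟧) :
    IsContracting (resolventSource S g) := by
  rintro m m' N ⟨d, hd⟩
  refine ⟨2 * g * d, ?_⟩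
  rw [resolventSource, resolventSource]
  linear_combination 2 * X * g * hd

theorem seriesDx_resC (S : Loop) :
    seriesDx (resC S) = 2 * density S * resC S - lowerEntry S := by
  set e := formalFix (dxAddInv (-1) (by norm_num)) (resolventSource S (densityTail S)) with he
  have h : seriesDx e - e = resolventSource S (densityTail S) e := by
    ext1 n
    rw [map_sub, coeff_seriesDx, he, coeff_formalFix _ (resolventSource_contracting S _), ← he]
    have h := dxAddInv_spec (c := -1) (by norm_num)
      (coeff n (resolventSource S (densityTail S) e))
    rwa [neg_one_smul, ← sub_eq_add_neg] at h
  rw [resolventSource] at h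
  rw [resC, ← he, lowerEntry, density_eq]
  simp only [map_add, Derivation.leibniz, seriesDx_X, smul_eq_mul, seriesDx_half]
  linear_combination X * h - (half + X * e + X * densityTail S) * two_mul_half

theorem coeff_zero_resC (S : Loop) : coeff 0 (resC S) = const (1 / 2) := by
  simp [resC, half]

/-- The upper left entry of the resolvent. -/
noncomputable def resA (S : Loop) : Fn⟦X⟧ := resC S * slope S - half

/-- The upper right entry of the resolvent. -/
noncomputable def resB (S : Loop) : Fn⟦X⟧ := slope S - resC S * slope S ^ 2

/-- The resolvent `W = !![a, b; c, -a]` is half the difference of the two spectral projections of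
the linear problem, so that `W² = 1/4`. -/
theorem resolvent_sq (S : Loop) : resA S ^ 2 + resB S * resC S = half ^ 2 := by
  rw [resA, resB]
  linear_combination -(resC S * slope S) * two_mul_half

theorem seriesDx_resA (S : Loop) : seriesDx (resA S)
    = (half - C (qOf S) * X) * resC S - lowerEntry S * resB S := by
  rw [resA, resB]
  simp only [map_sub, Derivation.leibniz, seriesDx_half, smul_eq_mul, seriesDx_slope,
    seriesDx_resC, density]
  ring

theorem seriesDx_resB (S : Loop) : seriesDx (resB S)
    = -2 * C (pOf S) * X * resB S - 2 * (half - C (qOf S) * X) * resA S := by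
  rw [resA, resB]
  simp only [map_sub, Derivation.leibniz, Derivation.leibniz_pow, smul_eq_mul, nsmul_eq_mul,
    seriesDx_slope, seriesDx_resC, density]
  push_cast
  linear_combination (C (qOf S) * X - half) * two_mul_half

theorem seriesDx_resC' (S : Loop) : seriesDx (resC S)
    = 2 * lowerEntry S * resA S + 2 * C (pOf S) * X * resC S := by
  rw [seriesDx_resC, density, resA]
  linear_combination lowerEntry S * two_mul_half

/-! ### Loops in coordinates -/

theorem Loop.ext {V W : Loop} (hp : pOf V = pOf W) (hq : qOf V = qOf W) (hr : rOf V = rOf W) :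
    V = W := by
  have hV : Matrix.trace V.1 = 0 := V.2
  have hW : Matrix.trace W.1 = 0 := W.2
  rw [Matrix.trace_fin_two] at hV hW
  apply Subtype.ext
  ext1 i j
  fin_cases i <;> fin_cases j
  · exact hp
  · exact hq
  · exact hr
  · change V.1 0 0 = W.1 0 0 at hp
    change V.1 1 1 = W.1 1 1
    linear_combination hV - hW - hp

theorem Loop.apply_one_one (V : Loop) : V.1 1 1 = -pOf V := by
  have hV : Matrix.trace V.1 = 0 := V.2
  rw [Matrix.trace_fin_two] at hV
  rw [pOf]
  linear_combination hV

@[simp] theorem pOf_mk (p q r : Fn) : pOf (mk p q r) = p := rfl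
@[simp] theorem qOf_mk (p q r : Fn) : qOf (mk p q r) = q := rfl
@[simp] theorem rOf_mk (p q r : Fn) : rOf (mk p q r) = r := rfl
@[simp] theorem pOf_zero : pOf 0 = 0 := rfl
@[simp] theorem qOf_zero : qOf 0 = 0 := rfl
@[simp] theorem rOf_zero : rOf 0 = 0 := rfl
@[simp] theorem pOf_add (V W : Loop) : pOf (V + W) = pOf V + pOf W := rfl
@[simp] theorem qOf_add (V W : Loop) : qOf (V + W) = qOf V + qOf W := rfl
@[simp] theorem rOf_add (V W : Loop) : rOf (V + W) = rOf V + rOf W := rfl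
@[simp] theorem pOf_sub (V W : Loop) : pOf (V - W) = pOf V - pOf W := rfl
@[simp] theorem qOf_sub (V W : Loop) : qOf (V - W) = qOf V - qOf W := rfl
@[simp] theorem rOf_sub (V W : Loop) : rOf (V - W) = rOf V - rOf W := rfl
@[simp] theorem pOf_smul (c : ℝ) (V : Loop) : pOf (c • V) = c • pOf V := rfl
@[simp] theorem qOf_smul (c : ℝ) (V : Loop) : qOf (c • V) = c • qOf V := rfl
@[simp] theorem rOf_smul (c : ℝ) (V : Loop) : rOf (c • V) = c • rOf V := rfl

theorem trace_mul (V W : Loop) :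
    Matrix.trace (V.1 * W.1) = 2 * pOf V * pOf W + qOf V * rOf W + rOf V * qOf W := by
  rw [Matrix.trace_fin_two, Matrix.mul_apply, Matrix.mul_apply, Fin.sum_univ_two,
    Fin.sum_univ_two, V.apply_one_one, W.apply_one_one, pOf, pOf, qOf, qOf, rOf, rOf]
  ring

theorem pairing_eq (V W : Loop) :
    pairing V W = integral (2 * pOf V * pOf W + qOf V * rOf W + rOf V * qOf W) := by
  rw [pairing, trace_mul]

theorem bracketWith_eq (S V : Loop) : bracketWith S V
    = mk (qOf V * rOf S - qOf S * rOf V) (2 * (pOf V * qOf S - qOf V * pOf S))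
      (2 * (rOf V * pOf S - pOf V * rOf S)) := by
  have h : (bracketWith S V).1 = V.1 * S.1 - S.1 * V.1 := rfl
  have h2 : ∀ i j, (bracketWith S V).1 i j
      = V.1 i 0 * S.1 0 j + V.1 i 1 * S.1 1 j - (S.1 i 0 * V.1 0 j + S.1 i 1 * V.1 1 j) := by
    intro i j
    rw [h, Matrix.sub_apply, Matrix.mul_apply, Matrix.mul_apply, Fin.sum_univ_two,
      Fin.sum_univ_two]
  apply Loop.ext
  · rw [pOf, h2, pOf_mk, qOf, qOf, rOf, rOf]; ring
  · rw [qOf, h2, qOf_mk, V.apply_one_one, S.apply_one_one, pOf, pOf, qOf, qOf]; ring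
  · rw [rOf, h2, rOf_mk, V.apply_one_one, S.apply_one_one, pOf, pOf, rOf, rOf]; ring

theorem matA_eq : matA = mk 0 (const (1 / 2)) (const (1 / 2)) := by
  apply Loop.ext <;> simp [matA, smul_eq_const_mul]

theorem P₁_eq (S V : Loop) : P₁ S V
    = mk (qOf V * rOf S - qOf S * rOf V) (2 * (pOf V * qOf S - qOf V * pOf S))
      (2 * (rOf V * pOf S - pOf V * rOf S)) :=
  bracketWith_eq S V

theorem P₂_eq (S V : Loop) : P₂ S V
    = mk (dx (pOf V) + const (1 / 2) * (qOf V - rOf V)) (dx (qOf V) + pOf V)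
      (dx (rOf V) - pOf V) := by
  have h : P₂ S V = loopDx V + bracketWith matA V := rfl
  have hp : pOf (loopDx V) = dx (pOf V) := rfl
  have hq : qOf (loopDx V) = dx (qOf V) := rfl
  have hr : rOf (loopDx V) = dx (rOf V) := rfl
  have hu := two_mul_const_half
  rw [h, bracketWith_eq, matA_eq]
  apply Loop.ext
  · simp only [pOf_add, pOf_mk, qOf_mk, rOf_mk, hp]; ring
  · simp only [pOf_mk, qOf_add, qOf_mk, hq]; linear_combination pOf V * hu
  · simp only [pOf_mk, rOf_add, rOf_mk, hr]; linear_combination -(pOf V) * hu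

/-! ### The Poisson pair on the loop space -/

theorem pairing_comm (V W : Loop) : pairing V W = pairing W V := by
  rw [pairing, pairing, Matrix.trace_mul_comm]

theorem pairing_add_right (V W W' : Loop) :
    pairing V (W + W') = pairing V W + pairing V W' := by
  rw [pairing_eq, pairing_eq, pairing_eq, ← integral_add]
  congr 1
  simp only [pOf_add, qOf_add, rOf_add]
  ring

theorem pairing_smul_right (c : ℝ) (V W : Loop) : pairing V (c • W) = c * pairing V W := by
  rw [pairing_eq, pairing_eq, ← integral_smul]
  congr 1
  simp only [pOf_smul, qOf_smul, rOf_smul, smul_eq_const_mul]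
  ring

theorem pairing_P₁_comm (S V W : Loop) : pairing V (P₁ S W) = -pairing (P₁ S V) W := by
  rw [pairing_eq, pairing_eq, ← integral_neg]
  congr 1
  simp only [P₁_eq, pOf_mk, qOf_mk, rOf_mk]
  ring

theorem pairing_P₂_comm (S V W : Loop) : pairing V (P₂ S W) = -pairing (P₂ S V) W := by
  rw [pairing_eq, pairing_eq, ← integral_neg]
  apply integral_eq_of_sub_eq_dx (2 * pOf V * pOf W + qOf V * rOf W + rOf V * qOf W)
  simp only [P₂_eq, pOf_mk, qOf_mk, rOf_mk, map_add, Derivation.leibniz, smul_eq_mul, dx_two]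
  linear_combination
    (pOf V * (qOf W - rOf W) + pOf W * (qOf V - rOf V)) * two_mul_const_half

/-- At each `S` the operator `s P₁ + t P₂` is a skew-symmetric derivation of the Lie algebra of
loops, which gives the Jacobi identity. -/
theorem isBihamiltonianPair_loop : IsBihamiltonianPair pairing Set.univ P₁ P₂ := by
  intro s t
  have happ : ∀ S V : Loop, (s • P₁ S + t • P₂ S) V = s • P₁ S V + t • P₂ S V := fun _ _ => rfl
  refine ⟨fun S _ a b => ?_, fun S _ a b c => ?_⟩
  · rw [happ, happ, pairing_add_right, pairing_add_right, pairing_smul_right, pairing_smul_right,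
      pairing_smul_right, pairing_smul_right, pairing_P₁_comm, pairing_P₂_comm,
      pairing_comm _ b, pairing_comm _ b]
    ring
  · have hd : ∀ a b V : Loop, HasDerivAt
        (fun τ : ℝ => pairing a ((s • P₁ (S + τ • V) + t • P₂ (S + τ • V)) b))
        (s * pairing a (P₁ V b)) 0 := by
      intro a b V
      have e : ∀ τ : ℝ, pairing a ((s • P₁ (S + τ • V) + t • P₂ (S + τ • V)) b)
          = pairing a ((s • P₁ S + t • P₂ S) b) + τ * (s * pairing a (P₁ V b)) := by
        intro τ
        have h1 : P₁ (S + τ • V) b = P₁ S b + τ • P₁ V b := by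
          apply Loop.ext <;>
          simp only [P₁_eq, pOf_mk, qOf_mk, rOf_mk, pOf_add, qOf_add, rOf_add, pOf_smul, qOf_smul,
            rOf_smul, smul_eq_const_mul] <;> ring
        have h2 : P₂ (S + τ • V) b = P₂ S b := rfl
        simp only [happ, h1, h2, pairing_add_right, pairing_smul_right]
        ring
      simp only [e]
      simpa using ((hasDerivAt_id (0 : ℝ)).mul_const (s * pairing a (P₁ V b))).const_add
        (pairing a ((s • P₁ S + t • P₂ S) b))
    refine ⟨_, _, _, hd _ _ _, hd _ _ _, hd _ _ _, ?_⟩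
    rw [← mul_add, ← mul_add]
    refine mul_eq_zero_of_right s ?_
    rw [pairing_eq, pairing_eq, pairing_eq, ← integral_add, ← integral_add, ← integral_zero]
    -- the integrand is the derivative of `t` times the invariant triple product of `a`, `b`, `c`
    apply integral_eq_of_sub_eq_dx (const t * (2 * pOf c * (qOf a * rOf b - qOf b * rOf a)
      + 2 * pOf b * (qOf c * rOf a - qOf a * rOf c) + 2 * pOf a * (qOf b * rOf c - qOf c * rOf b)))
    simp only [happ, P₁_eq, P₂_eq, pOf_mk, qOf_mk, rOf_mk, pOf_add, qOf_add, rOf_add, pOf_smul,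
      qOf_smul, rOf_smul, smul_eq_const_mul, map_add, map_sub, Derivation.leibniz, smul_eq_mul,
      dx_two, dx_const]
    ring

/-! ### The gradients of the Hamiltonians -/

/-- The Hamiltonians `H_j = ∫ h_j dx`. -/
noncomputable def hamiltonian (j : ℕ) (S : Loop) : ℝ := integral (coeff j (density S))

/-- The gradients `dH_j`, that is, the coefficients of `-W/λ` for the resolvent `W`. The value at
`j = 0`, which has no meaning, is that at `j = 1`. -/
noncomputable def gradient (j : ℕ) (S : Loop) : Loop :=
  mk (-coeff (j - 1) (resA S)) (-coeff (j - 1) (resB S)) (-coeff (j - 1) (resC S))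

theorem exists_velocity_slope (S V : Loop) :
    ∃ G, HasSeriesVelocity (fun t : ℝ => slope (S + t • V)) G := by
  obtain ⟨G, hG⟩ := exists_velocity_formalFix (dxAddInv 1 one_ne_zero)
    (Φ := fun t => slopeSource (S + t • V)) (fun F G h => by
      have h1 := (HasSeriesVelocity.constant 1).add ((HasSeriesVelocity.constant X).mul h)
      simp only [slopeSource, sq]
      exact ⟨_, ((((HasSeriesVelocity.C_line (rOf S) (rOf V)).mul (h1.mul h1)).sub
        (HasSeriesVelocity.C_line (qOf S) (qOf V))).sub
        (((HasSeriesVelocity.constant 2).mul (HasSeriesVelocity.C_line (pOf S) (pOf V))).mul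
          h1)).sub (((HasSeriesVelocity.constant half).mul (HasSeriesVelocity.constant X)).mul
            (h.mul h))⟩)
  exact ⟨_, (HasSeriesVelocity.constant 1).add ((HasSeriesVelocity.constant X).mul hG)⟩

theorem velocity_lowerEntry (S V : Loop) :
    HasSeriesVelocity (fun t : ℝ => lowerEntry (S + t • V)) (-(C (rOf V) * X)) :=
  ((HasSeriesVelocity.constant half).sub
    ((HasSeriesVelocity.C_line (rOf S) (rOf V)).mul (HasSeriesVelocity.constant X))).of_eq
      (by simp)

/-- The linearization of the equation for the slope. -/
theorem seriesDx_velocity_slope {S V : Loop} {G : Fn⟦X⟧}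
    (hG : HasSeriesVelocity (fun t : ℝ => slope (S + t • V)) G) :
    seriesDx G = -(C (qOf V) * X) - 2 * C (pOf V) * X * slope S + C (rOf V) * X * slope S ^ 2
      - 2 * density S * G := by
  have h1 := hG.seriesDx
  simp only [seriesDx_slope, sq] at h1
  have cX := HasSeriesVelocity.constant (X : Fn⟦X⟧)
  refine (h1.unique ((((HasSeriesVelocity.constant half).sub
    ((HasSeriesVelocity.C_line (qOf S) (qOf V)).mul cX)).sub
    ((((HasSeriesVelocity.constant 2).mul (HasSeriesVelocity.C_line (pOf S) (pOf V))).mul cX).mul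
      hG)).sub ((velocity_lowerEntry S V).mul (hG.mul hG)))).trans ?_
  simp only [zero_smul, add_zero, density]
  ring

/-- The variation of the density, up to a total derivative, is minus the trace of the product of
the resolvent and the variation of `S/λ`. -/
theorem exists_velocity_density (S V : Loop) : ∃ w : Fn⟦X⟧,
    HasSeriesVelocity (fun t : ℝ => density (S + t • V))
      (seriesDx w - X * (2 * C (pOf V) * resA S + C (rOf V) * resB S + C (qOf V) * resC S)) := by
  obtain ⟨G, hG⟩ := exists_velocity_slope S V
  refine ⟨-(resC S * G), (((velocity_lowerEntry S V).mul hG).add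
    ((HasSeriesVelocity.C_line (pOf S) (pOf V)).mul (HasSeriesVelocity.constant X))).of_eq ?_⟩
  simp only [zero_smul, add_zero, map_neg, Derivation.leibniz, smul_eq_mul,
    seriesDx_velocity_slope hG, seriesDx_resC, resA, resB]
  linear_combination -(C (pOf V) * X) * two_mul_half

theorem isGradient_hamiltonian (j : ℕ) (S : Loop) :
    IsGradient pairing (hamiltonian (j + 1)) S (gradient (j + 1) S) := by
  intro V
  obtain ⟨w, hw⟩ := exists_velocity_density S V
  refine ((hw (j + 1)).hasDerivAt integralₗ).congr_deriv ?_
  rw [pairing_eq]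
  apply integral_eq_of_sub_eq_dx (coeff (j + 1) w)
  rw [show 2 * C (pOf V) * resA S = C (2 * pOf V) * resA S by rw [map_mul, map_ofNat]]
  simp only [map_sub, map_add, coeff_succ_X_mul, coeff_C_mul, coeff_seriesDx, gradient, pOf_mk,
    qOf_mk, rOf_mk, Nat.add_sub_cancel]
  ring

theorem coeff_zero_resA (S : Loop) : coeff 0 (resA S) = 0 := by
  have h := coeff_zero_slope S
  have h' := coeff_zero_resC S
  rw [coeff_zero_eq_constantCoeff_apply] at *
  simp [resA, h, h', half]

theorem coeff_zero_resB (S : Loop) : coeff 0 (resB S) = const (1 / 2) := by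
  have h := coeff_zero_slope S
  have h' := coeff_zero_resC S
  rw [coeff_zero_eq_constantCoeff_apply] at *
  rw [resB, map_sub, map_mul, map_pow, h, h']
  linear_combination -two_mul_const_half

theorem P₂_gradient_one (S : Loop) : P₂ S (gradient 1 S) = 0 := by
  rw [P₂_eq, gradient, Nat.sub_self, coeff_zero_resA, coeff_zero_resB, coeff_zero_resC]
  apply Loop.ext <;> simp only [pOf_mk, qOf_mk, rOf_mk, map_neg, dx_const, pOf_zero, qOf_zero,
    rOf_zero, map_zero] <;> ring

/-- The Lenard recursion is the equation `W_x = [A - S/λ, W]` for the resolvent. -/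
theorem P₂_gradient_succ (j : ℕ) (S : Loop) :
    P₂ S (gradient (j + 2) S) = P₁ S (gradient (j + 1) S) := by
  have hA := congrArg (coeff (j + 1)) (seriesDx_resA S)
  have hB := congrArg (coeff (j + 1)) (seriesDx_resB S)
  have hC := congrArg (coeff (j + 1)) (seriesDx_resC' S)
  have eA : (half - C (qOf S) * X) * resC S - lowerEntry S * resB S = half * (resC S - resB S)
    + X * (C (rOf S) * resB S - C (qOf S) * resC S) := by rw [lowerEntry]; ring
  have eB : -2 * C (pOf S) * X * resB S - 2 * (half - C (qOf S) * X) * resA S = -resA S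
      + X * (C (2 * qOf S) * resA S - C (2 * pOf S) * resB S) := by
    rw [map_mul, map_mul, map_ofNat]
    linear_combination -(resA S) * two_mul_half
  have eC : 2 * lowerEntry S * resA S + 2 * C (pOf S) * X * resC S = resA S
      + X * (C (2 * pOf S) * resC S - C (2 * rOf S) * resA S) := by
    rw [map_mul, map_mul, map_ofNat, lowerEntry]
    linear_combination (resA S) * two_mul_half
  rw [eA, half] at hA
  rw [eB] at hB
  rw [eC] at hC
  simp only [coeff_seriesDx, map_add, map_sub, map_neg, coeff_C_mul, coeff_succ_X_mul] at hA hB hC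
  rw [P₂_eq, P₁_eq, gradient, gradient, show j + 2 - 1 = j + 1 from rfl, Nat.add_sub_cancel]
  apply Loop.ext
  · simp only [pOf_mk, qOf_mk, rOf_mk, map_neg]; linear_combination -hA
  · simp only [pOf_mk, qOf_mk, rOf_mk, map_neg]; linear_combination -hB
  · simp only [pOf_mk, qOf_mk, rOf_mk, map_neg]; linear_combination -hC

theorem isBihamiltonianHierarchy_loop :
    IsBihamiltonianHierarchy pairing Set.univ P₁ P₂ hamiltonian gradient where
  pair := isBihamiltonianPair_loop
  gradient j hj S _ := by
    obtain ⟨i, rfl⟩ := Nat.exists_eq_add_of_le' hj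
    exact isGradient_hamiltonian i S
  casimir S _ := P₂_gradient_one S
  recursion j hj S _ := by
    obtain ⟨i, rfl⟩ := Nat.exists_eq_add_of_le' hj
    exact P₂_gradient_succ i S

theorem trace_gradient_sq (S : Loop) (n : ℕ) :
    const (1 / 2) * ∑ ij ∈ Finset.HasAntidiagonal.antidiagonal n,
        Matrix.trace ((gradient (ij.1 + 1) S).1 * (gradient (ij.2 + 1) S).1)
      = if n = 0 then const (1 / 4) else 0 := by
  have h := congrArg (coeff n) (resolvent_sq S)
  have hr : half ^ 2 = C (const (1 / 4)) := by rw [const_quarter, half, map_pow]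
  rw [hr, coeff_C] at h
  rw [← h, map_add, sq, coeff_mul, coeff_mul, ← Finset.sum_add_distrib]
  have e : ∀ ij : ℕ × ℕ, Matrix.trace ((gradient (ij.1 + 1) S).1 * (gradient (ij.2 + 1) S).1)
      = 2 * (coeff ij.1 (resA S) * coeff ij.2 (resA S))
        + coeff ij.1 (resB S) * coeff ij.2 (resC S)
        + coeff ij.1 (resC S) * coeff ij.2 (resB S) := by
    intro ij
    simp only [trace_mul, gradient, pOf_mk, qOf_mk, rOf_mk, Nat.add_sub_cancel]
    ring
  have hcomm : ∑ ij ∈ Finset.HasAntidiagonal.antidiagonal n,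
        coeff ij.1 (resC S) * coeff ij.2 (resB S)
      = ∑ ij ∈ Finset.HasAntidiagonal.antidiagonal n,
        coeff ij.1 (resB S) * coeff ij.2 (resC S) := by
    rw [← coeff_mul, ← coeff_mul, mul_comm]
  simp only [e, Finset.sum_add_distrib, hcomm, ← Finset.mul_sum]
  linear_combination (∑ ij ∈ Finset.HasAntidiagonal.antidiagonal n,
        coeff ij.1 (resA S) * coeff ij.2 (resA S)
      + ∑ ij ∈ Finset.HasAntidiagonal.antidiagonal n,
        coeff ij.1 (resB S) * coeff ij.2 (resC S)) * two_mul_const_half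

/-! ### The first two Hamiltonians -/

theorem density_recursion (S : Loop) (i : ℕ) :
    coeff (i + 1) (density S) + dx (coeff (i + 1) (density S))
      = riccatiSource S (fun i => coeff i (density S)) i :=
  (isRiccatiSolution_iff_recursion S _ (coeff_zero_density S)).1 (density_isRiccatiSolution S) i

theorem integral_eq_of_add_dx {f g : Fn} (h : f + dx f = g) : integral f = integral g := by
  rw [← h, integral_add, integral_dx, add_zero]

theorem integral_const_mul (c : ℝ) (f : Fn) : integral (const c * f) = c * integral f := by
  rw [← smul_eq_const_mul, integral_smul]

theorem const_neg_half : const (-(1 / 2)) = -const (1 / 2) := map_neg (algebraMap ℝ Fn) _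

theorem hamiltonian_one (S : Loop) :
    hamiltonian 1 S = -(1 / 2) * integral (rOf S + qOf S) := by
  rw [hamiltonian, integral_eq_of_add_dx (density_recursion S 0), ← integral_const_mul,
    const_neg_half]
  apply integral_eq_of_sub_eq_dx (pOf S - rOf S)
  simp only [riccatiSource, riccatiCoeff, coeff_zero_density, dx_const, Finset.sum_range_succ,
    Finset.sum_range_zero, Nat.sub_self, map_sub]
  linear_combination (rOf S * const (1 / 2) + rOf S - dx (rOf S)) * two_mul_const_half

/-- The equation for `h_1` is `1 + ∂_x` applied to the asserted equality. -/
theorem density_one {S : Loop} {γ : Fn}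
    (hγ : dx (dx γ) - γ = const (1 / 2) * (qOf S - rOf S) - dx (pOf S)) :
    coeff 1 (density S) = γ - dx γ - rOf S := by
  apply add_dx_injective
  rw [density_recursion S 0]
  simp only [riccatiSource, riccatiCoeff, coeff_zero_density, dx_const, Finset.sum_range_succ,
    Finset.sum_range_zero, Nat.sub_self, map_sub]
  linear_combination (rOf S * const (1 / 2) - dx (rOf S)) * two_mul_const_half + hγ

/-- The integrand is the right-hand side of the recursion for `h_2`, with `h_1` and `q` expressed
through `γ`. -/
theorem hamiltonian_two {S : Loop} {γ : Fn}
    (hγ : dx (dx γ) - γ = const (1 / 2) * (qOf S - rOf S) - dx (pOf S)) :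
    hamiltonian 2 S = integral (pOf S ^ 2 - γ ^ 2 - dx γ ^ 2) := by
  rw [hamiltonian, integral_eq_of_add_dx (density_recursion S 1)]
  apply integral_eq_of_sub_eq_dx
    (2 * rOf S * dx γ - 2 * rOf S * γ + 2 * rOf S * pOf S + γ ^ 2)
  simp only [riccatiSource, riccatiCoeff, coeff_zero_density, Finset.sum_range_succ,
    Finset.sum_range_zero, Nat.sub_self, density_one hγ, map_sub, map_add, Derivation.leibniz,
    Derivation.leibniz_pow, smul_eq_mul, nsmul_eq_mul, dx_two, zero_add, Nat.sub_zero]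
  push_cast
  linear_combination (-4 * rOf S) * hγ
    - 2 * rOf S * (dx γ - γ + qOf S) * two_mul_const_half

theorem slope_one {S : Loop} {γ : Fn}
    (hγ : dx (dx γ) - γ = const (1 / 2) * (qOf S - rOf S) - dx (pOf S)) :
    coeff 1 (slope S) = 2 * γ - 2 * dx γ - 2 * pOf S := by
  have h := density_one hγ
  have e : density S = C (const (1 / 2)) * slope S + X * (C (pOf S) - C (rOf S) * slope S) := by
    rw [density, lowerEntry, half]; ring
  rw [e, map_add, coeff_C_mul, coeff_succ_X_mul, map_sub, coeff_zero_C, coeff_C_mul,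
    coeff_zero_slope] at h
  linear_combination 2 * h - coeff 1 (slope S) * two_mul_const_half

theorem coeff_one_mul (F G : Fn⟦X⟧) :
    coeff 1 (F * G) = coeff 0 F * coeff 1 G + coeff 1 F * coeff 0 G := by
  rw [coeff_mul, Finset.Nat.antidiagonal_succ]
  simp

theorem resC_one {S : Loop} {γ : Fn}
    (hγ : dx (dx γ) - γ = const (1 / 2) * (qOf S - rOf S) - dx (pOf S)) :
    coeff 1 (resC S) = -γ := by
  have h := congrArg (coeff 1) (seriesDx_resC S)
  have e : 2 * density S * resC S - lowerEntry S
      = C 2 * (density S * resC S) - C (const (1 / 2)) + X * C (rOf S) := by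
    rw [map_ofNat, lowerEntry, half]; ring
  rw [e, coeff_seriesDx, map_add, map_sub, coeff_C_mul, coeff_one_mul, coeff_succ_C,
    coeff_succ_X_mul, coeff_zero_C, density_one hγ, coeff_zero_density, coeff_zero_resC] at h
  apply sub_dx_injective
  rw [map_neg]
  linear_combination -h - (γ - dx γ - rOf S + coeff 1 (resC S)) * two_mul_const_half

theorem resA_one {S : Loop} {γ : Fn}
    (hγ : dx (dx γ) - γ = const (1 / 2) * (qOf S - rOf S) - dx (pOf S)) :
    coeff 1 (resA S) = -dx γ - pOf S := by
  rw [resA, map_sub, coeff_one_mul, coeff_zero_resC, coeff_zero_slope, resC_one hγ, slope_one hγ,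
    half, coeff_succ_C]
  linear_combination (γ - dx γ - pOf S) * two_mul_const_half

theorem resB_one {S : Loop} {γ : Fn}
    (hγ : dx (dx γ) - γ = const (1 / 2) * (qOf S - rOf S) - dx (pOf S)) :
    coeff 1 (resB S) = γ := by
  have h : coeff 0 (slope S * slope S) = 1 := by
    rw [coeff_mul, Finset.Nat.antidiagonal_zero, Finset.sum_singleton, coeff_zero_slope, one_mul]
  rw [resB, map_sub, sq, coeff_one_mul, coeff_one_mul, h, coeff_zero_resC, coeff_zero_slope,
    resC_one hγ, slope_one hγ]
  linear_combination -(2 * (γ - dx γ - pOf S)) * two_mul_const_half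

theorem P₁_gradient_two {S : Loop} {γ : Fn}
    (hγ : dx (dx γ) - γ = const (1 / 2) * (qOf S - rOf S) - dx (pOf S)) :
    P₁ S (gradient 2 S) = mk (-γ * (rOf S + qOf S)) (2 * qOf S * (dx γ + pOf S) + 2 * pOf S * γ)
      (2 * pOf S * γ - 2 * rOf S * (pOf S + dx γ)) := by
  rw [P₁_eq, gradient, show 2 - 1 = 1 from rfl, resA_one hγ, resB_one hγ, resC_one hγ]
  apply Loop.ext <;> simp only [pOf_mk, qOf_mk, rOf_mk] <;> ring

/-! ### The leaf and its transversal submanifold -/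

theorem Fn.exists_mul_eq_one {f : Fn} (h : f ∈ nonvanishing) : ∃ g : Fn, f * g = 1 :=
  ⟨⟨fun x => (f.1 x)⁻¹, f.2.1.inv h, fun x => by
    change (f.1 (x + 1))⁻¹ = (f.1 x)⁻¹
    rw [f.2.2 x]⟩, Fn.ext fun x => mul_inv_cancel₀ (h x)⟩

theorem eq_zero_of_nonvanishing_mul {q f : Fn} (hq : q ∈ nonvanishing) (h : q * f = 0) :
    f = 0 := by
  obtain ⟨g, hg⟩ := Fn.exists_mul_eq_one hq
  linear_combination g * h - f * hg

theorem mem_tangentLeaf (S V : Loop) : V ∈ tangentLeaf S ↔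
    2 * pOf S * pOf V + rOf S * qOf V + qOf S * rOf V = 0 := Iff.rfl

theorem P₁_mem_tangentLeaf (S W : Loop) : P₁ S W ∈ tangentLeaf S := by
  rw [mem_tangentLeaf]
  simp only [P₁_eq, pOf_mk, qOf_mk, rOf_mk]
  ring

/-- A tangent vector `V` is `[W, S]` for `W = -[Sᵀ, V] / (2 tr (S Sᵀ))`, which is smooth because
`S` vanishes nowhere. -/
theorem tangentLeaf_eq_range {S : Loop} (hS : S ∈ leaf) :
    tangentLeaf S = LinearMap.range (P₁ S) := by
  refine le_antisymm (fun V hV => ?_) ?_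
  · obtain ⟨g, hg⟩ := Fn.exists_mul_eq_one
      (f := 2 * pOf S ^ 2 + qOf S ^ 2 + rOf S ^ 2) (fun x hx => hS.2 x (by
        change 2 * (pOf S).1 x ^ 2 + (qOf S).1 x ^ 2 + (rOf S).1 x ^ 2 = 0 at hx
        have hp : (pOf S).1 x ^ 2 = 0 := by
          linarith [sq_nonneg ((pOf S).1 x), sq_nonneg ((qOf S).1 x), sq_nonneg ((rOf S).1 x)]
        have hq : (qOf S).1 x ^ 2 = 0 := by
          linarith [sq_nonneg ((pOf S).1 x), sq_nonneg ((qOf S).1 x), sq_nonneg ((rOf S).1 x)]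
        have hr : (rOf S).1 x ^ 2 = 0 := by
          linarith [sq_nonneg ((pOf S).1 x), sq_nonneg ((qOf S).1 x), sq_nonneg ((rOf S).1 x)]
        rw [pow_eq_zero_iff two_ne_zero] at hp hq hr
        rw [hp, hq, hr]))
    rw [mem_tangentLeaf] at hV
    -- `tr (S V) = 0` and `[[Sᵀ, V], S] = -2 tr (S Sᵀ) V + 2 tr (S V) Sᵀ`
    refine ⟨mk (-(const (1 / 2) * g * (rOf S * rOf V - qOf S * qOf V)))
      (-(g * (pOf S * qOf V - rOf S * pOf V))) (-(g * (qOf S * pOf V - pOf S * rOf V))), ?_⟩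
    apply Loop.ext <;> simp only [P₁_eq, pOf_mk, qOf_mk, rOf_mk]
    · linear_combination pOf V * hg - g * pOf S * hV
    · linear_combination qOf V * hg - g * rOf S * hV
        - g * qOf S * (rOf S * rOf V - qOf S * qOf V) * two_mul_const_half
    · linear_combination rOf V * hg - g * qOf S * hV
        + g * rOf S * (rOf S * rOf V - qOf S * qOf V) * two_mul_const_half
  · rintro _ ⟨W, rfl⟩
    exact P₁_mem_tangentLeaf S W

@[simp] theorem pOf_embQ (q : Fn) : pOf (embQ q) = 0 := rfl
@[simp] theorem qOf_embQ (q : Fn) : qOf (embQ q) = q := rfl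
@[simp] theorem rOf_embQ (q : Fn) : rOf (embQ q) = 0 := rfl

theorem embQ_mem_leaf {q : Fn} (hq : q ∈ nonvanishing) : embQ q ∈ leaf := by
  refine ⟨by simp, fun x h => hq x ?_⟩
  exact (Prod.ext_iff.1 (Prod.ext_iff.1 h).2).1

theorem mem_tangentLeaf_embQ {q : Fn} (hq : q ∈ nonvanishing) (V : Loop) :
    V ∈ tangentLeaf (embQ q) ↔ rOf V = 0 := by
  rw [mem_tangentLeaf]
  simp only [pOf_embQ, qOf_embQ, rOf_embQ, mul_zero, zero_mul, zero_add]
  exact ⟨eq_zero_of_nonvanishing_mul hq, fun h => by rw [h, mul_zero]⟩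

theorem mem_distD_embQ {q : Fn} (hq : q ∈ nonvanishing) (W : Loop) :
    W ∈ distD (embQ q) ↔ ∃ f, W = mk (const (1 / 2) * f) (dx f) 0 := by
  constructor
  · rintro ⟨V, hV, rfl⟩
    have hV' : P₁ (embQ q) V = 0 := hV
    rw [P₁_eq] at hV'
    have h1 := congrArg pOf hV'
    have h2 := congrArg qOf hV'
    simp only [pOf_mk, qOf_mk, pOf_embQ, qOf_embQ, rOf_embQ, pOf_zero, qOf_zero, mul_zero,
      zero_sub, neg_eq_zero, sub_zero] at h1 h2
    have hr : rOf V = 0 := eq_zero_of_nonvanishing_mul hq h1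
    have hp : pOf V = 0 := eq_zero_of_nonvanishing_mul hq (by
      linear_combination const (1 / 2) * h2 - q * pOf V * two_mul_const_half)
    refine ⟨qOf V, ?_⟩
    rw [P₂_eq, hr, hp]
    simp
  · rintro ⟨f, rfl⟩
    refine ⟨embQ f, ?_, ?_⟩
    · change P₁ (embQ q) (embQ f) = 0
      rw [P₁_eq]
      apply Loop.ext <;> simp
    · rw [P₂_eq]
      simp

theorem mem_distE_embQ {q : Fn} (hq : q ∈ nonvanishing) (W : Loop) :
    W ∈ distE (embQ q) ↔ ∃ f, W = mk (const (1 / 2) * f) (dx f) 0 := by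
  rw [distE, Submodule.mem_inf, mem_distD_embQ hq, mem_tangentLeaf_embQ hq]
  refine ⟨And.left, fun h => ⟨h, ?_⟩⟩
  obtain ⟨f, rfl⟩ := h
  rfl

/-- Subtracting the element of `E` with the same entry `p` shows that `!![p, q; 0, -p]` projects
to `q - 2 p_x`. -/
theorem projectsTo_iff {q : Fn} (hq : q ∈ nonvanishing) (W : Loop) (b : Fn) :
    ProjectsTo q W b ↔ rOf W = 0 ∧ b = qOf W - 2 * dx (pOf W) := by
  rw [ProjectsTo, mem_tangentLeaf_embQ hq, mem_distE_embQ hq]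
  refine and_congr_right fun hr => ⟨?_, fun hb => ⟨2 * pOf W, ?_⟩⟩
  · rintro ⟨f, hf⟩
    have h1 := congrArg pOf hf
    have h2 := congrArg qOf hf
    simp only [pOf_sub, qOf_sub, pOf_embQ, qOf_embQ, sub_zero, pOf_mk, qOf_mk] at h1 h2
    have h3 := congrArg dx h1
    simp only [Derivation.leibniz, dx_const, smul_eq_mul, mul_zero, add_zero] at h3
    linear_combination 2 * h3 - h2 + dx f * two_mul_const_half
  · apply Loop.ext
    · simp only [pOf_sub, pOf_embQ, pOf_mk]
      linear_combination -(pOf W) * two_mul_const_half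
    · simp only [qOf_sub, qOf_embQ, qOf_mk, Derivation.leibniz, dx_two, smul_eq_mul]
      linear_combination -hb
    · simp only [rOf_sub, rOf_embQ, rOf_mk, hr, sub_zero]

theorem tangentQ_inf_distE {q : Fn} (hq : q ∈ nonvanishing) : tangentQ ⊓ distE (embQ q) = ⊥ := by
  rw [eq_bot_iff]
  rintro _ ⟨⟨b, rfl⟩, h⟩
  obtain ⟨f, hf⟩ := (mem_distE_embQ hq _).1 h
  have h1 := congrArg pOf hf
  have h2 := congrArg qOf hf
  simp only [pOf_embQ, qOf_embQ, pOf_mk, qOf_mk] at h1 h2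
  have h3 : f = 0 := by linear_combination -2 * h1 - f * two_mul_const_half
  rw [Submodule.mem_bot, h2, h3, map_zero, map_zero]

theorem tangentQ_sup_distE {q : Fn} (hq : q ∈ nonvanishing) :
    tangentQ ⊔ distE (embQ q) = tangentLeaf (embQ q) := by
  refine le_antisymm (sup_le ?_ inf_le_right) fun W hW => ?_
  · rintro _ ⟨b, rfl⟩
    exact (mem_tangentLeaf_embQ hq _).2 rfl
  · have h := (projectsTo_iff hq W _).2 ⟨(mem_tangentLeaf_embQ hq W).1 hW, rfl⟩
    rw [← add_sub_cancel (embQ (qOf W - 2 * dx (pOf W))) W]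
    exact Submodule.add_mem_sup ⟨_, rfl⟩ h.2

/-! ### The reduced tensors -/

/-- The extensions of the covector `a` are the loops `!![a_x, ·; a, -a_x]`. -/
theorem isExtension_iff {q : Fn} (hq : q ∈ nonvanishing) (a : Fn) (α : Loop) :
    IsExtension q a α ↔ pOf α = dx a ∧ rOf α = a := by
  have hQ : ∀ b, pairing α (embQ b) = integral (rOf α * b) := fun b => by
    rw [pairing_eq]
    simp
  have hD : ∀ f, pairing α (mk (const (1 / 2) * f) (dx f) 0)
      = integral ((pOf α - dx (rOf α)) * f) := fun f => by
    rw [pairing_eq]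
    apply integral_eq_of_sub_eq_dx (rOf α * f)
    simp only [pOf_mk, qOf_mk, rOf_mk, Derivation.leibniz, smul_eq_mul]
    linear_combination pOf α * f * two_mul_const_half
  constructor
  · rintro ⟨h1, h2⟩
    have hr : rOf α = a := sub_eq_zero.1 (eq_zero_of_integral_mul fun b => by
      rw [sub_mul, integral_sub, ← hQ, h2, pairingQ, sub_self])
    refine ⟨?_, hr⟩
    rw [← hr]
    exact sub_eq_zero.1 (eq_zero_of_integral_mul fun f => by
      rw [← hD]
      exact h1 _ ((mem_distD_embQ hq _).2 ⟨f, rfl⟩))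
  · rintro ⟨hp, hr⟩
    refine ⟨fun W hW => ?_, fun b => by rw [hQ, hr, pairingQ]⟩
    obtain ⟨f, rfl⟩ := (mem_distD_embQ hq _).1 hW
    rw [hD, hp, hr, sub_self, zero_mul, integral_zero]

theorem chP₁_apply (q a : Fn) : chP₁ q a = 4 * q * dx a + 2 * dx q * a := by
  change (2 : ℝ) • ((2 : ℝ) • (q * dx a) + dx q * a) = _
  rw [two_smul, two_smul]
  ring

theorem chP₂_apply (q a : Fn) : chP₂ q a = 2 * dx a - 2 * dx (dx (dx a)) := by
  change (2 : ℝ) • (-dx (dx (dx a)) + dx a) = _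
  rw [two_smul]
  ring

theorem isReduction_P₁ : IsReduction P₁ chP₁ := by
  intro q hq a
  refine ⟨⟨mk (dx a) 0 a, (isExtension_iff hq a _).2 ⟨rfl, rfl⟩⟩, fun α hα => ?_⟩
  obtain ⟨hp, hr⟩ := (isExtension_iff hq a α).1 hα
  rw [projectsTo_iff hq, P₁_eq, chP₁_apply]
  simp only [pOf_mk, qOf_mk, rOf_mk, pOf_embQ, qOf_embQ, rOf_embQ, hp, hr, mul_zero, sub_zero,
    zero_sub, map_neg, Derivation.leibniz, smul_eq_mul, true_and]
  ring

theorem isReduction_P₂ : IsReduction P₂ chP₂ := by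
  intro q hq a
  refine ⟨⟨mk (dx a) 0 a, (isExtension_iff hq a _).2 ⟨rfl, rfl⟩⟩, fun α hα => ?_⟩
  obtain ⟨hp, hr⟩ := (isExtension_iff hq a α).1 hα
  rw [projectsTo_iff hq, P₂_eq, chP₂_apply]
  simp only [pOf_mk, qOf_mk, rOf_mk, hp, hr, sub_self, map_add, map_sub, Derivation.leibniz,
    dx_const, smul_eq_mul, mul_zero, add_zero, true_and]
  linear_combination (dx (qOf α) - dx a) * two_mul_const_half

/-! ### The reduced hierarchy -/

/-- With `v = P c`, the derivative of `{ℓ_a, ℓ_b}` along `P c` is `2s ∫ v (a b_x - a_x b) dx`, and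
the cyclic sum of these integrands is a total derivative. -/
theorem isBihamiltonianPair_camassaHolm :
    IsBihamiltonianPair pairingQ nonvanishing chP₁ chP₂ := by
  intro s t
  have happ : ∀ q a : Fn, (s • chP₁ q + t • chP₂ q) a
      = const s * (4 * q * dx a + 2 * dx q * a) + const t * (2 * dx a - 2 * dx (dx (dx a))) := by
    intro q a
    rw [← chP₁_apply, ← chP₂_apply q, ← smul_eq_const_mul, ← smul_eq_const_mul]
    rfl
  refine ⟨fun q _ a b => ?_, fun q _ a b c => ?_⟩
  · rw [pairingQ, pairingQ, ← integral_neg]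
    apply integral_eq_of_sub_eq_dx (const s * (4 * q * a * b)
      + const t * (2 * a * b - 2 * (a * dx (dx b) + b * dx (dx a)) + 2 * dx a * dx b))
    simp only [happ, map_add, map_sub, Derivation.leibniz, smul_eq_mul, dx_const, dx_two, dx_four]
    ring
  · have hd : ∀ a b v : Fn, HasDerivAt
        (fun τ : ℝ => pairingQ a ((s • chP₁ (q + τ • v) + t • chP₂ (q + τ • v)) b))
        (integral (const s * (a * (4 * v * dx b + 2 * dx v * b)))) 0 := by
      intro a b v
      have e : ∀ τ : ℝ, pairingQ a ((s • chP₁ (q + τ • v) + t • chP₂ (q + τ • v)) b)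
          = pairingQ a ((s • chP₁ q + t • chP₂ q) b)
            + τ * integral (const s * (a * (4 * v * dx b + 2 * dx v * b))) := by
        intro τ
        rw [← integral_smul, pairingQ, pairingQ, ← integral_add]
        congr 1
        simp only [happ, smul_eq_const_mul, map_add, Derivation.leibniz, dx_const, smul_eq_mul]
        ring
      simp only [e]
      simpa using ((hasDerivAt_id (0 : ℝ)).mul_const
        (integral (const s * (a * (4 * v * dx b + 2 * dx v * b))))).const_add
        (pairingQ a ((s • chP₁ q + t • chP₂ q) b))
    refine ⟨_, _, _, hd _ _ _, hd _ _ _, hd _ _ _, ?_⟩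
    rw [← integral_add, ← integral_add, ← integral_zero]
    set A := (s • chP₁ q + t • chP₂ q) a with hA
    set B := (s • chP₁ q + t • chP₂ q) b with hB
    set G := (s • chP₁ q + t • chP₂ q) c with hG
    -- the products `a b (P c)` move the derivative off `P c`; in the remaining cyclic sum of
    -- `(P c) (a b_x - a_x b)` only the third derivatives contribute, and they add up to the
    -- derivative of the cyclic sum of `c_xx (a b_x - a_x b)`
    apply integral_eq_of_sub_eq_dx (const s * (2 * (a * b * G + b * c * A + c * a * B)
      - 4 * const t * (dx (dx c) * (a * dx b - dx a * b) + dx (dx a) * (b * dx c - dx b * c)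
        + dx (dx b) * (c * dx a - dx c * a))))
    simp only [map_add, map_sub, Derivation.leibniz, smul_eq_mul, dx_const, dx_two, dx_four]
    rw [hA, hB, hG]
    simp only [happ]
    ring

/-- The gradients of the Hamiltonians annihilate the distribution `D`: for `W = P₂ X` with
`P₁ X = 0`, moving the tensors to the other side gives
`⟨dH_{j+1}, P₂ X⟩ = -⟨P₁ dH_j, X⟩ = ⟨dH_j, P₁ X⟩ = 0`. -/
theorem pairing_gradient_distD {j : ℕ} (hj : 1 ≤ j) {S W : Loop} (hW : W ∈ distD S) :
    pairing (gradient j S) W = 0 := by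
  obtain ⟨Y, hY, rfl⟩ := hW
  have hY' : P₁ S Y = 0 := hY
  have hz : ∀ V, pairing V 0 = 0 := fun V => by simpa using pairing_smul_right 0 V 0
  obtain ⟨i, rfl⟩ := Nat.exists_eq_add_of_le' hj
  rw [pairing_P₂_comm]
  cases i with
  | zero => rw [P₂_gradient_one, pairing_comm, hz, neg_zero]
  | succ i => rw [P₂_gradient_succ, ← pairing_P₁_comm, hY', hz]

/-- The gradients of the restrictions of the Hamiltonians to `𝒬`. -/
noncomputable def reducedGradient (j : ℕ) (q : Fn) : Fn := rOf (gradient j (embQ q))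

theorem pairing_embQ (V : Loop) (b : Fn) : pairing V (embQ b) = pairingQ (rOf V) b := by
  rw [pairing_eq, pairingQ]
  simp

theorem isExtension_gradient {j : ℕ} (hj : 1 ≤ j) (q : Fn) :
    IsExtension q (reducedGradient j q) (gradient j (embQ q)) :=
  ⟨fun _ hW => pairing_gradient_distD hj hW, fun b => pairing_embQ _ b⟩

theorem reducesTo : ReducesTo hamiltonian gradient (fun j q => hamiltonian j (embQ q))
    reducedGradient where
  constant _ hj _ _ _ hW := pairing_gradient_distD hj hW.1
  restrict _ _ _ _ := rfl
  tangent _ _ S _ := P₁_mem_tangentLeaf S _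
  project₁ _ hj q hq := (isReduction_P₁ q hq _).2 _ (isExtension_gradient hj q)
  project₂ _ hj q hq := (isReduction_P₂ q hq _).2 _ (isExtension_gradient hj q)

theorem projectsTo_unique {q : Fn} (hq : q ∈ nonvanishing) {W : Loop} {b b' : Fn}
    (h : ProjectsTo q W b) (h' : ProjectsTo q W b') : b = b' :=
  ((projectsTo_iff hq W b).1 h).2.trans ((projectsTo_iff hq W b').1 h').2.symm

/-- The Lenard recursion on `𝒬` is the projection of that on the loop space. -/
theorem isBihamiltonianHierarchy_camassaHolm :
    IsBihamiltonianHierarchy pairingQ nonvanishing chP₁ chP₂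
      (fun j q => hamiltonian j (embQ q)) reducedGradient where
  pair := isBihamiltonianPair_camassaHolm
  gradient j hj q _ v := by
    rw [reducedGradient, ← pairing_embQ]
    have h := isBihamiltonianHierarchy_loop.gradient j hj (embQ q) trivial (embQ v)
    simpa only [map_add, map_smul] using h
  casimir q hq := by
    have h := reducesTo.project₂ 1 le_rfl q hq
    rw [P₂_gradient_one] at h
    exact projectsTo_unique hq h ((projectsTo_iff hq 0 0).2 (by simp))
  recursion j hj q hq := by
    have h := reducesTo.project₂ (j + 1) (by omega) q hq
    rw [isBihamiltonianHierarchy_loop.recursion j hj (embQ q) trivial] at h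
    exact projectsTo_unique hq h (reducesTo.project₁ j hj q hq)

theorem reducedGradient_two {q γ : Fn} (hγ : dx (dx γ) - γ = const (1 / 2) * q) :
    reducedGradient 2 q = γ := by
  have h := resC_one (S := embQ q) (γ := γ) (by simpa using hγ)
  rw [reducedGradient, gradient, rOf_mk, show 2 - 1 = 1 from rfl, h, neg_neg]

theorem isNonlocalCHHierarchy :
    IsNonlocalCHHierarchy (fun j q => hamiltonian j (embQ q)) reducedGradient where
  density q _ := ⟨fun i => PowerSeries.coeff i (density (embQ q)),
    (isScalarRiccatiSolution_iff q _).2 (density_isRiccatiSolution _), coeff_zero_density _,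
    fun h' hh' h0' => (density_isRiccatiSolution (embQ q)).unique
      ((isScalarRiccatiSolution_iff q h').1 hh') (coeff_zero_density _) h0', fun _ _ => rfl⟩
  start q _ := by rw [hamiltonian_one, rOf_embQ, qOf_embQ, zero_add]
  hierarchy := isBihamiltonianHierarchy_camassaHolm
  camassaHolm u _ := by
    rw [reducedGradient_two (γ := -(const (1 / 2) * u)), chP₁_apply]
    · simp only [map_sub, map_neg, Derivation.leibniz, dx_const, smul_eq_mul, mul_zero, add_zero]
      linear_combination (-2 * (u - dx (dx u)) * dx u - (dx u - dx (dx (dx u))) * u)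
        * two_mul_const_half
    · simp only [map_neg, Derivation.leibniz, dx_const, smul_eq_mul, mul_zero, add_zero]
      ring

end MatrixCH

theorem mainTheorem1 :
    -- `1 + ∂_x` is invertible, and `h_0 = ±1/2`; with `h_0 = 1/2`, the Riccati equation amounts to
    -- equations that give every further coefficient through the inverse of `1 + ∂_x`
    (∀ m : MatrixCH.Fn, ∃! f : MatrixCH.Fn, f + MatrixCH.dx f = m) ∧
    (∀ (S : MatrixCH.Loop) (h : ℕ → MatrixCH.Fn), MatrixCH.IsRiccatiSolution S h →
      h 0 = MatrixCH.const (1 / 2) ∨ h 0 = MatrixCH.const (-(1 / 2))) ∧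
    (∀ (S : MatrixCH.Loop) (h : ℕ → MatrixCH.Fn), h 0 = MatrixCH.const (1 / 2) →
      (MatrixCH.IsRiccatiSolution S h ↔
        ∀ i : ℕ, h (i + 1) + MatrixCH.dx (h (i + 1)) = MatrixCH.riccatiSource S h i)) ∧
    -- the formal solution `h` with `h_0 = 1/2`
    ∃ h : MatrixCH.Loop → ℕ → MatrixCH.Fn,
      (∀ S, MatrixCH.IsRiccatiSolution S (h S) ∧ h S 0 = MatrixCH.const (1 / 2) ∧
        ∀ h', MatrixCH.IsRiccatiSolution S h' → h' 0 = MatrixCH.const (1 / 2) → h' = h S) ∧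
      ∃ (H : ℕ → MatrixCH.Loop → ℝ) (dH : ℕ → MatrixCH.Loop → MatrixCH.Loop),
        (∀ j S, H j S = MatrixCH.integral (h S j)) ∧
        -- the hierarchy, whose formal Casimir `∑ H_j λ^{-j}` has `tr (dH)² / 2 = 1 / (4λ²)`
        MatrixCH.IsBihamiltonianHierarchy MatrixCH.pairing Set.univ
          MatrixCH.P₁ MatrixCH.P₂ H dH ∧
        (∀ (S : MatrixCH.Loop) (n : ℕ),
          MatrixCH.const (1 / 2) * ∑ ij ∈ Finset.HasAntidiagonal.antidiagonal n,
              Matrix.trace ((dH (ij.1 + 1) S).1 * (dH (ij.2 + 1) S).1)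
            = if n = 0 then MatrixCH.const (1 / 4) else 0) ∧
        -- the first two functionals
        (∀ S, H 1 S = -(1 / 2) * MatrixCH.integral (MatrixCH.rOf S + MatrixCH.qOf S)) ∧
        (∀ S, ∃! γ : MatrixCH.Fn, MatrixCH.dx (MatrixCH.dx γ) - γ
          = MatrixCH.const (1 / 2) * (MatrixCH.qOf S - MatrixCH.rOf S)
            - MatrixCH.dx (MatrixCH.pOf S)) ∧
        (∀ (S : MatrixCH.Loop) (γ : MatrixCH.Fn), MatrixCH.dx (MatrixCH.dx γ) - γ
            = MatrixCH.const (1 / 2) * (MatrixCH.qOf S - MatrixCH.rOf S)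
              - MatrixCH.dx (MatrixCH.pOf S) →
          H 2 S = MatrixCH.integral (MatrixCH.pOf S ^ 2 - γ ^ 2 - MatrixCH.dx γ ^ 2) ∧
          MatrixCH.P₁ S (dH 2 S) = MatrixCH.mk
            (-γ * (MatrixCH.rOf S + MatrixCH.qOf S))
            (2 * MatrixCH.qOf S * (MatrixCH.dx γ + MatrixCH.pOf S) + 2 * MatrixCH.pOf S * γ)
            (2 * MatrixCH.pOf S * γ - 2 * MatrixCH.rOf S * (MatrixCH.pOf S + MatrixCH.dx γ))) ∧
        -- the bi-Hamiltonian reduction: the submanifolds `𝒮` and `𝒬`, the reduced Poisson pair,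
        -- and the reduced hierarchy
        (∀ S ∈ MatrixCH.leaf, MatrixCH.tangentLeaf S = LinearMap.range (MatrixCH.P₁ S)) ∧
        (∀ q ∈ MatrixCH.nonvanishing, MatrixCH.embQ q ∈ MatrixCH.leaf ∧
          MatrixCH.tangentQ ⊓ MatrixCH.distE (MatrixCH.embQ q) = ⊥ ∧
          MatrixCH.tangentQ ⊔ MatrixCH.distE (MatrixCH.embQ q)
            = MatrixCH.tangentLeaf (MatrixCH.embQ q)) ∧
        MatrixCH.IsReduction MatrixCH.P₁ MatrixCH.chP₁ ∧
        MatrixCH.IsReduction MatrixCH.P₂ MatrixCH.chP₂ ∧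
        ∃ (K : ℕ → MatrixCH.Fn → ℝ) (dK : ℕ → MatrixCH.Fn → MatrixCH.Fn),
          MatrixCH.ReducesTo H dH K dK ∧ MatrixCH.IsNonlocalCHHierarchy K dK := by
  refine ⟨MatrixCH.existsUnique_add_dx, fun S h hh => hh.leading,
    MatrixCH.isRiccatiSolution_iff_recursion, fun S i => PowerSeries.coeff i (MatrixCH.density S),
    fun S => ⟨MatrixCH.density_isRiccatiSolution S, MatrixCH.coeff_zero_density S,
      fun h' hh' h0' => (MatrixCH.density_isRiccatiSolution S).unique hh'
        (MatrixCH.coeff_zero_density S) h0'⟩,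
    MatrixCH.hamiltonian, MatrixCH.gradient, fun j S => rfl,
    MatrixCH.isBihamiltonianHierarchy_loop, MatrixCH.trace_gradient_sq, MatrixCH.hamiltonian_one,
    fun S => MatrixCH.existsUnique_helmholtz _,
    fun S γ hγ => ⟨MatrixCH.hamiltonian_two hγ, MatrixCH.P₁_gradient_two hγ⟩,
    fun S hS => MatrixCH.tangentLeaf_eq_range hS,
    fun q hq => ⟨MatrixCH.embQ_mem_leaf hq, MatrixCH.tangentQ_inf_distE hq,
      MatrixCH.tangentQ_sup_distE hq⟩,
    MatrixCH.isReduction_P₁, MatrixCH.isReduction_P₂,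
    fun j q => MatrixCH.hamiltonian j (MatrixCH.embQ q), MatrixCH.reducedGradient,
    MatrixCH.reducesTo, MatrixCH.isNonlocalCHHierarchy⟩
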